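/- Definitions. A splitting of a group $G$ is an action of $G$ without inversions on a simplicial tree $X$ (equivalently, by Bass–Serre theory, a graph of groups decomposition of $G$ with underlying graph $X/G$); its vertex and edge groups are the stabilizers $G_v$, $G_e$ of vertices and edges of $X$. It is reduced if, for every edge $e$ of $X/G$ that is not a loop, $G_e$ is a proper subgroup of the vertex groups of both endpoints of $e$. It is cyclic if every edge group is infinite cyclic, and acylindrical if there is $k\ge 0$ such that the pointwise stabilizer of every path of length greater than $k+1$ in $X$ is trivial. A vertex $v$ is degenerate if $G_v=G_e$ for some edge $e$ incident to $v$. Given a function $\varphi$ assigning to each group a value in $[0,\infty]$, the weighted complexity of a splitting of $G$ is $$C_X^{\varphi}(G)=r(X/G)+\sum_{v}\bigl(1+\varphi(G_v)\bigr),$$ where $r(X/G)$ is the rank of the free group $\pi_1(X/G)$ and the sum is over the non-degenerate vertices $v$ of $X/G$, if some element of $G$ fixes no vertex of $X$; otherwise $C_X^{\varphi}(G)=1$. For a class of splittings, let $C_{\max}^{\varphi}(G)\in[0,\infty]$ be the supremum of $C_X^{\varphi}(G)$ over all reduced splittings of $G$ in the class. The associated volume of $G$ is $$\limsup_{H\in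 N_G}\frac{C_{\max}^{\varphi}(H)}{[G:H]}\in[0,\infty],$$ where $N_G$ is the set of normal subgroups of finite index of $G$, directed by reverse inclusion. Let $V_{fin}$ be the volume given by the splittings with finite edge groups and $\varphi=0$. Let $V_1^{hyp}$ be the volume given by the acylindrical cyclic splittings and by the weight $\varphi(\Gamma)=V_{fin}(\Gamma)$ if $\Gamma$ is finitely presented and torsion-free, $\varphi(\Gamma)=0$ otherwise. Proposition. Let $G$ be a torsion-free, one-ended hyperbolic group which admits a cyclic splitting with a free non-abelian vertex group. Then $V_1^{hyp}(G)>0$. -/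

import Mathlib

open scoped ENNReal

universe u

/-! ## Groups: torsion-freeness, hyperbolicity, ends -/

/-- A group is torsion-free if its only element of finite order is the identity. -/
def IsTorsionFreeGroup (G : Type u) [Group G] : Prop :=
  ∀ g : G, IsOfFinOrder g → g = 1

/-- A group is (word-)hyperbolic if it has a finite generating set whose word metric, i.e. the
graph distance of the associated Cayley graph, satisfies Gromov's four-point condition. -/
def IsHyperbolicGroup (G : Type u) [Group G] : Prop :=
  ∃ S : Finset G, Subgroup.closure (S : Set G) = ⊤ ∧ ∃ δ : ℕ, ∀ x y z w : G,
    let d := (SimpleGraph.mulCayley (S : Set G)).dist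
    d x y + d z w ≤ max (d x z + d y w) (d x w + d y z) + 2 * δ

/-- A group is one-ended if it has a finite generating set whose Cayley graph has exactly one
end. -/
def IsOneEndedGroup (G : Type u) [Group G] : Prop :=
  ∃ S : Finset G, Subgroup.closure (S : Set G) = ⊤ ∧
    ∃! s, s ∈ (SimpleGraph.mulCayley (S : Set G)).end

/-! ## Splittings -/

/-- A splitting of `G`, given by its Bass-Serre tree: an action of `G` without inversions on a
simplicial tree. -/
structure Splitting (G : Type u) [Group G] where
  /-- The vertices of the tree. -/
  V : Type u
  /-- The tree. -/
  tree : SimpleGraph V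
  isTree : tree.IsTree
  /-- The action of `G` on the vertices. -/
  action : MulAction G V
  smul_adj : ∀ (g : G) (v w : V), tree.Adj v w → tree.Adj (g • v) (g • w)
  no_inversion : ∀ (g : G) (v w : V), tree.Adj v w → ¬ (g • v = w ∧ g • w = v)

namespace Splitting

variable {G : Type u} [Group G] (T : Splitting G)

instance instMulActionVertices : MulAction G T.V := T.action

/-- The action on the oriented edges of the tree. -/
instance instMulActionDart : MulAction G T.tree.Dart where
  smul g e := ⟨(g • e.fst, g • e.snd), T.smul_adj g _ _ e.adj⟩
  one_smul e := SimpleGraph.Dart.ext _ _ (Prod.ext (one_smul G e.fst) (one_smul G e.snd))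
  mul_smul g h e := SimpleGraph.Dart.ext _ _
    (Prod.ext (mul_smul g h e.fst) (mul_smul g h e.snd))

/-- The vertex group `G_v`: the stabilizer of a vertex of the tree. -/
abbrev vertexGroup (v : T.V) : Subgroup G := MulAction.stabilizer G v

/-- The edge group of an edge with endpoints `v` and `w`. As there are no inversions, it is the
pointwise stabilizer of the two endpoints. -/
abbrev edgeGroup (v w : T.V) : Subgroup G := T.vertexGroup v ⊓ T.vertexGroup w

/-- The vertices of the quotient graph. -/
abbrev QuotientVertex : Type u := MulAction.orbitRel.Quotient G T.V

/-- The oriented edges of the quotient graph. -/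
abbrev QuotientEdge : Type u := MulAction.orbitRel.Quotient G T.tree.Dart

/-- The initial vertex of an oriented edge of the quotient graph. -/
def origin : T.QuotientEdge → T.QuotientVertex :=
  Quotient.map (fun e : T.tree.Dart => e.fst) (by
    rintro a b ⟨g, rfl⟩
    exact ⟨g, rfl⟩)

/-- The orientation reversal of the quotient graph. -/
def reverse : T.QuotientEdge → T.QuotientEdge :=
  Quotient.map (fun e : T.tree.Dart => e.symm) (by
    rintro a b ⟨g, rfl⟩
    exact ⟨g, rfl⟩)

/-- The first homology `H_1(X/G; ℚ)` of the quotient graph: the finitely supported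
antisymmetric functions on oriented edges whose values on the edges leaving any given vertex
add up to zero. -/
def quotientCycles : Submodule ℚ (T.QuotientEdge →₀ ℚ) where
  carrier := {c | (∀ e, c (T.reverse e) = - c e) ∧ Finsupp.lmapDomain ℚ ℚ T.origin c = 0}
  zero_mem' := ⟨fun _ => by simp, map_zero _⟩
  add_mem' := fun {a b} ha hb =>
    ⟨fun e => by rw [Finsupp.add_apply, Finsupp.add_apply, ha.1, hb.1, neg_add],
      by rw [map_add, ha.2, hb.2, add_zero]⟩
  smul_mem' := fun r a ha =>
    ⟨fun e => by rw [Finsupp.smul_apply, Finsupp.smul_apply, ha.1, smul_neg],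
      by rw [map_smul, ha.2, smul_zero]⟩

/-- The rank `r(X/G)` of the free group `π₁(X/G)`, i.e. the first Betti number of the quotient
graph (`⊤` if it is infinite). -/
noncomputable def quotientRank : ℕ∞ := Cardinal.toENat (Module.rank ℚ T.quotientCycles)

/-- A vertex is degenerate if its group coincides with the group of an incident edge. -/
def IsDegenerate (v : T.V) : Prop := ∃ w, T.tree.Adj v w ∧ T.edgeGroup v w = T.vertexGroup v

/-- A splitting is reduced if for each edge that does not project to a loop of the quotient
graph, the edge group is properly contained in the vertex groups of both endpoints. -/
def IsReduced : Prop :=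
  ∀ v w : T.V, T.tree.Adj v w → w ∉ MulAction.orbit G v →
    T.edgeGroup v w ≠ T.vertexGroup v ∧ T.edgeGroup v w ≠ T.vertexGroup w

/-- A splitting over finite groups. -/
def HasFiniteEdgeGroups : Prop :=
  ∀ v w : T.V, T.tree.Adj v w → Finite (T.edgeGroup v w)

/-- A cyclic splitting: each edge group is infinite cyclic. -/
def IsCyclicSplitting : Prop :=
  ∀ v w : T.V, T.tree.Adj v w → IsCyclic (T.edgeGroup v w) ∧ Infinite (T.edgeGroup v w)

/-- `k`-acylindricity: the (pointwise) stabilizer of any path of length greater than `k + 1` is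
trivial. An automorphism of a tree fixes a path pointwise iff it fixes both endpoints. -/
def IsAcylindricalWith (k : ℕ) : Prop :=
  ∀ v w : T.V, k + 1 < T.tree.dist v w → T.vertexGroup v ⊓ T.vertexGroup w = ⊥

/-- Acylindricity: `k`-acylindricity for some `k`. -/
def IsAcylindrical : Prop := ∃ k : ℕ, T.IsAcylindricalWith k

/-- A hyperbolic element of `G` is one that fixes no vertex of the tree. -/
def IsHyperbolicElement (g : G) : Prop := ∀ v : T.V, g • v ≠ v

open Classical in
/-- The weighted complexity of a splitting, where `φ` weighs the vertex groups:
`r(X/G) + ∑ (1 + φ(G_v))`, summed over the non-degenerate vertices of `X/G`, if `G` contains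
hyperbolic elements, and `1` otherwise. Each vertex of `X/G` is represented by a chosen lift. -/
noncomputable def weightedComplexity (φ : (Γ : Type u) → [Group Γ] → ℝ≥0∞) : ℝ≥0∞ :=
  if ∃ g : G, T.IsHyperbolicElement g then
    (T.quotientRank : ℝ≥0∞) +
      ∑' q : {q : T.QuotientVertex // ¬ T.IsDegenerate q.out}, (1 + φ (T.vertexGroup q.1.out))
  else 1

end Splitting

/-! ## Volumes -/

/-- The maximal weighted complexity of `G` over all its reduced splittings in the class `P`. -/
noncomputable def maxComplexity (P : (Γ : Type u) → [Group Γ] → Splitting Γ → Prop)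
    (φ : (Γ : Type u) → [Group Γ] → ℝ≥0∞) (G : Type u) [Group G] : ℝ≥0∞ :=
  ⨆ (T : Splitting G) (_ : T.IsReduced ∧ P G T), T.weightedComplexity φ

/-- The volume of `G` with respect to a class `P` of splittings and a weight `φ`: the upper limit
of `C_max(H) / [G : H]` over the normal subgroups `H` of finite index, directed by reverse
inclusion. -/
noncomputable def splittingVolume (P : (Γ : Type u) → [Group Γ] → Splitting Γ → Prop)
    (φ : (Γ : Type u) → [Group Γ] → ℝ≥0∞) (G : Type u) [Group G] : ℝ≥0∞ :=
  Filter.limsup (fun H : FiniteIndexNormalSubgroup G =>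
    maxComplexity P φ H.toSubgroup / (H.toSubgroup.index : ℝ≥0∞)) Filter.atBot

/-- `V_fin`: the volume defined by splittings over finite groups and the unweighted
complexity. -/
noncomputable def Vfin (G : Type u) [Group G] : ℝ≥0∞ :=
  splittingVolume (fun _ _ T => T.HasFiniteEdgeGroups) (fun _ _ => 0) G

open Classical in
/-- The weight of a vertex group: `V_fin` on finitely presented torsion-free groups, and `0`
otherwise. -/
noncomputable def hypWeight (Γ : Type u) [Group Γ] : ℝ≥0∞ :=
  if Group.IsFinitelyPresented Γ ∧ IsTorsionFreeGroup Γ then Vfin Γ else 0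

/-- `V_1^{hyp}`: the volume defined by acylindrical cyclic splittings and the complexity weighted
by `V_fin`. -/
noncomputable def V1hyp (G : Type u) [Group G] : ℝ≥0∞ :=
  splittingVolume (fun _ _ T => T.IsCyclicSplitting ∧ T.IsAcylindrical)
    (fun Γ _ => hypWeight Γ) G

/-!
Every normal subgroup `H` of finite index satisfies `C_max(H) ≥ [G : H]`, so the volume is at
least `1`.

As `G` is finitely generated, the translates of finitely many paths span a cocompact subtree
through `v` (`Splitting.exists_cocompact`). A cocompact cyclic splitting of a hyperbolic group is
acylindrical (`Splitting.isAcylindrical_of_isHyperbolicGroup`): if a nontrivial element fixes two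
edges `e` and `t e` of one orbit, then `t c ^ p t⁻¹ = c ^ q` for some `p, q ≠ 0`, where `c`
generates the group of `e`, and up to powers of `c` there are only finitely many such `t`
(`IsHyperbolicGroup.exists_finite_commensurator`); this bounds the length of a path with
nontrivial stabilizer. In a cocompact cyclic splitting the vertex groups are finitely generated
(`Splitting.fg_vertexGroup`), so `F = G_v` is a finitely generated nonabelian free group.

Restrict the action to `H` and collapse edges until the splitting is reduced. This removes only
vertices with cyclic groups (`Splitting.exists_reduced`), hence no vertex in the orbit of `v`, and
the vertices of that orbit are non-degenerate because their groups are not cyclic. They form at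
least `[G : H] / [F : F ∩ H]` orbits under `H` (`Splitting.index_le_card_mul_relIndex`), each with
vertex group isomorphic to `F ∩ H`. The weight of this group is at least `[F : F ∩ H]`
(`FreeCut.index_le_hypWeight`): writing `F` as a free product `B * ⟨t⟩` gives a tree on which a
subgroup of index `n` acts with trivial edge groups, infinite vertex groups and `n` orbits of
edges, and in the quotient graph the rank plus the number of vertices is at least the number of
edges. So the orbits in `G • v` contribute at least `[G : H]` to the complexity.

One-endedness enters only to exclude that `G` fixes `v`: then `G` would be free and nonabelian,
and such a group is not one-ended (`FreeCut.not_isOneEndedGroup`). When `G` moves `v`, there are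
elements of `H` without fixed vertices (`Splitting.exists_isHyperbolicElement`), so that the
complexity is given by the sum.
-/

/-! ### Trees -/

namespace SimpleGraph

variable {V W : Type*} {Γ : SimpleGraph V} {Δ : SimpleGraph W}

/-- In an acyclic graph every edge cuts its component in two: there is a set of vertices which is
left only through this edge. -/
lemma IsAcyclic.exists_cut (h : Γ.IsAcyclic) {x y : V} (hxy : Γ.Adj x y) :
    ∃ P : V → Prop, P x ∧ ¬ P y ∧ ∀ a b, Γ.Adj a b → P a → ¬ P b → a = x ∧ b = y := by
  have hb := isAcyclic_iff_forall_adj_isBridge.1 h hxy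
  refine ⟨fun z => (Γ.deleteEdges {s(x, y)}).Reachable x z, Reachable.refl _, ?_, ?_⟩
  · simpa [IsBridge, deleteEdges] using hb
  · intro a b hab ha hnb
    have hP : s(a, b) = s(x, y) := by
      by_contra hne
      exact hnb (ha.trans (Adj.reachable (by simp [deleteEdges_adj, hab]; simpa using hne)))
    rcases Sym2.eq_iff.1 hP with h1 | ⟨h1, h2⟩
    · exact h1
    · exact absurd (by rw [h2]) hnb

/-- A graph in which every edge is cut off by a set of vertices is acyclic. -/
lemma isAcyclic_of_forall_exists_cut
    (h : ∀ x y, Γ.Adj x y → ∃ P : V → Prop, (P x ∧ ¬ P y) ∧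
      ∀ a b, Γ.Adj a b → P a → ¬ P b → s(a, b) = s(x, y)) : Γ.IsAcyclic := by
  rw [isAcyclic_iff_forall_adj_isBridge]
  intro x y hxy
  obtain ⟨P, ⟨hx, hy⟩, hP⟩ := h x y hxy
  suffices H : ∀ a z, (Γ.deleteEdges {s(x, y)}).Walk a z → P a → P z by
    rw [isBridge_iff]
    rintro ⟨w⟩
    exact hy (H x y w hx)
  intro a z w
  induction w with
  | nil => exact id
  | @cons a b c hab _ ih =>
    rw [deleteEdges_adj] at hab
    intro ha
    by_contra hc
    exact hab.2 (hP a b hab.1 ha fun hb => hc (ih hb))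

/-- A locally injective homomorphism to an acyclic graph maps paths to paths. -/
lemma Walk.IsPath.map_of_locally_injective (hΔ : Δ.IsAcyclic) (π : Γ →g Δ)
    (hπ : ∀ p q q', Γ.Adj p q → Γ.Adj p q' → π q = π q' → q = q') {p q : V} {w : Γ.Walk p q}
    (hw : w.IsPath) : (w.map π).IsPath := by
  induction w with
  | nil => simp
  | @cons a b c hab w ih =>
    have hw' := (Walk.cons_isPath_iff _ _).1 hw
    have h2 := (hΔ.isPath_iff_isChain _).1 (ih hw'.1)
    rw [hΔ.isPath_iff_isChain, Walk.map_cons, Walk.edges_cons]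
    refine List.isChain_cons.2 ⟨?_, h2⟩
    cases w with
    | nil => simp
    | @cons b d c hbd w =>
      intro y hy he
      simp only [Walk.map_cons, Walk.edges_cons, List.head?_cons, Option.mem_def,
        Option.some.injEq] at hy
      rw [← hy, Sym2.eq_iff] at he
      have had : π d = π a := by
        rcases he with ⟨h1, _⟩ | ⟨h1, _⟩
        · exact absurd h1 (π.map_adj hab).ne
        · exact h1.symm
      have := hπ b d a hbd hab.symm had
      exact hw'.2 (by simp [← this])

/-- A locally injective homomorphism to an acyclic graph is injective on components. -/
lemma eq_of_reachable_of_locally_injective (hΔ : Δ.IsAcyclic) (π : Γ →g Δ)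
    (hπ : ∀ p q q', Γ.Adj p q → Γ.Adj p q' → π q = π q' → q = q') {p q : V}
    (hpq : Γ.Reachable p q) (h : π p = π q) : p = q := by
  obtain ⟨w, hw⟩ := hpq.exists_isPath
  have h1 := hw.map_of_locally_injective hΔ π hπ
  by_contra hne
  cases w with
  | nil => exact hne rfl
  | cons hab w =>
    rw [Walk.map_cons, Walk.cons_isPath_iff, h] at h1
    exact h1.2 (Walk.end_mem_support _)

/-- In a tree only one neighbour of a vertex is closer to a given vertex. -/
lemma IsTree.eq_of_dist_eq_add_one (h : Γ.IsTree) {x a a' b : V} (hab : Γ.Adj a b)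
    (hab' : Γ.Adj a' b) (hd : Γ.dist x b = Γ.dist x a + 1) (hd' : Γ.dist x b = Γ.dist x a' + 1) :
    a = a' := by
  obtain ⟨p, hp⟩ := h.connected.exists_walk_length_eq_dist x a
  obtain ⟨p', hp'⟩ := h.connected.exists_walk_length_eq_dist x a'
  have h1 : (p.concat hab).IsPath := Walk.isPath_of_length_eq_dist _ (by simp [hp, hd])
  have h2 : (p'.concat hab').IsPath := Walk.isPath_of_length_eq_dist _ (by simp [hp', hd'])
  have h3 := (h.existsUnique_path x b).unique h1 h2
  have := congrArg Walk.penultimate h3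
  simpa using this

/-- A vertex which is separated from `a` by the last edge `(c, b)` of a geodesic from `a` to `b`
is reached from `a` through `b`. -/
lemma IsTree.dist_eq_add_of_dist_eq_add_one (h : Γ.IsTree) {a b c y : V} (hcb : Γ.Adj c b)
    (hac : Γ.dist a b = Γ.dist a c + 1) (hy : Γ.dist y c = Γ.dist y b + 1) :
    Γ.dist y a = Γ.dist y b + Γ.dist a b := by
  obtain ⟨n, hn⟩ : ∃ n, Γ.dist a c = n := ⟨_, rfl⟩
  induction n generalizing b c with
  | zero =>
    have : a = c := h.connected.dist_eq_zero_iff.1 hn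
    subst this
    rw [hac, hn, hy]
  | succ n ih =>
    obtain ⟨w, hw⟩ := h.connected.exists_walk_length_eq_dist c a
    cases w with
    | nil => simp at hn
    | @cons _ d _ hcd w =>
      have h0 : Γ.dist d a ≤ w.length := dist_le w
      have h1 : Γ.dist c a = Γ.dist a c := dist_comm
      have h1' : Γ.dist d a = Γ.dist a d := dist_comm
      simp only [Walk.length_cons] at hw
      have h2 : Γ.dist c a ≤ 1 + Γ.dist d a :=
        (h.connected.dist_triangle (v := d)).trans (by rw [dist_eq_one_iff_adj.2 hcd])
      have h3 : Γ.dist y d = Γ.dist y c + 1 := by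
        rcases h.dist_eq_dist_add_one_of_adj y hcd with h4 | h4
        · have := h.eq_of_dist_eq_add_one hcb.symm hcd.symm hy h4
          subst this
          omega
        · exact h4
      have := ih hcd.symm (by omega) h3 (by omega)
      omega

/-- The graph obtained from `Γ` by contracting the fibres of a map `ρ`. -/
def contract (Γ : SimpleGraph V) (ρ : V → W) : SimpleGraph W where
  Adj a b := a ≠ b ∧ ∃ x y, Γ.Adj x y ∧ ρ x = a ∧ ρ y = b
  symm := ⟨fun _ _ ⟨h, x, y, hxy, hx, hy⟩ => ⟨h.symm, y, x, hxy.symm, hy, hx⟩⟩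
  loopless := ⟨fun _ h => h.1 rfl⟩

section contract

variable {ρ : V → W}

lemma exists_walk_contract {x y : V} (w : Γ.Walk x y) :
    ∃ w' : (Γ.contract ρ).Walk (ρ x) (ρ y), w'.length ≤ w.length := by
  induction w with
  | nil => exact ⟨.nil, le_rfl⟩
  | @cons a b c hab w ih =>
    obtain ⟨w', hw'⟩ := ih
    by_cases he : ρ a = ρ b
    · rw [he]
      exact ⟨w', hw'.trans (by simp)⟩
    · exact ⟨.cons ⟨he, a, b, hab, rfl, rfl⟩ w', Nat.succ_le_succ hw'⟩

lemma dist_contract_le (h : Γ.Connected) (x y : V) :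
    (Γ.contract ρ).dist (ρ x) (ρ y) ≤ Γ.dist x y := by
  obtain ⟨w, hw⟩ := h.exists_walk_length_eq_dist x y
  obtain ⟨w', hw'⟩ := exists_walk_contract (ρ := ρ) w
  exact (dist_le w').trans (hw ▸ hw')

/-- When a map with connected fibres is contracted, each edge of the contracted graph comes from
one edge only. -/
lemma IsAcyclic.contract_edge_unique
    (hfib : ∀ P : V → Prop, (∀ x y, Γ.Adj x y → ρ x = ρ y → P x → P y) →
      ∀ x y, ρ x = ρ y → P x → P y)
    (h : Γ.IsAcyclic) {x y x' y' : V} (hxy : Γ.Adj x y)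
    (hxy' : Γ.Adj x' y') (hne : ρ x ≠ ρ y) (hx : ρ x = ρ x') (hy : ρ y = ρ y') :
    x' = x ∧ y' = y := by
  obtain ⟨P, hPx, hPy, hP⟩ := h.exists_cut hxy
  have hQ : ∀ a b, ρ a = ρ b → P a → P b := by
    refine hfib P fun a b hab he ha => ?_
    by_contra hb
    obtain ⟨rfl, rfl⟩ := hP a b hab ha hb
    exact hne he
  exact hP x' y' hxy' (hQ _ _ hx hPx) fun h' => hPy (hQ _ _ hy.symm h')

/-- Contracting the connected fibres of a map turns a tree into a tree. -/
lemma IsTree.contract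
    (hfib : ∀ P : V → Prop, (∀ x y, Γ.Adj x y → ρ x = ρ y → P x → P y) →
      ∀ x y, ρ x = ρ y → P x → P y)
    (h : Γ.IsTree) (hρ : Function.Surjective ρ) : (Γ.contract ρ).IsTree := by
  have := h.connected.nonempty
  refine ⟨(connected_iff _).2 ⟨fun a b => ?_, this.map ρ⟩, isAcyclic_of_forall_exists_cut ?_⟩
  · obtain ⟨x, rfl⟩ := hρ a
    obtain ⟨y, rfl⟩ := hρ b
    obtain ⟨w⟩ := h.connected.preconnected x y
    exact ⟨(exists_walk_contract w).choose⟩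
  · rintro _ _ ⟨hne, x, y, hxy, rfl, rfl⟩
    obtain ⟨P, hPx, hPy, hP⟩ := h.isAcyclic.exists_cut hxy
    have hQ : ∀ a b, ρ a = ρ b → P a → P b := by
      refine hfib P fun a b hab he ha => ?_
      by_contra hb
      obtain ⟨rfl, rfl⟩ := hP a b hab ha hb
      exact hne he
    refine ⟨fun a => ∃ z, ρ z = a ∧ P z, ⟨⟨x, rfl, hPx⟩, ?_⟩, ?_⟩
    · rintro ⟨z, hz, hPz⟩
      exact hPy (hQ _ _ hz hPz)
    · rintro _ _ ⟨-, a, b, hab, rfl, rfl⟩ ⟨z, hz, hPz⟩ hb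
      obtain ⟨rfl, rfl⟩ := hP a b hab (hQ _ _ hz hPz) fun h' => hb ⟨b, rfl, h'⟩
      rfl

end contract

end SimpleGraph

/-! ### Hyperbolic groups: commensurators of infinite cyclic subgroups -/

/-- The properties of the word metric of a hyperbolic group: a left-invariant discrete geodesic
metric with finite balls which satisfies the four-point condition. -/
structure IsHyperbolicWordMetric {G : Type*} [Group G] (d : G → G → ℕ) (D : ℕ) : Prop where
  self : ∀ x, d x x = 0
  comm : ∀ x y, d x y = d y x
  triangle : ∀ x y z, d x z ≤ d x y + d y z
  mul_left : ∀ g x y, d (g * x) (g * y) = d x y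
  finite_ball : ∀ n, {g | d 1 g ≤ n}.Finite
  geodesic : ∀ x y s, s ≤ d x y → ∃ p, d x p = s ∧ d p y = d x y - s
  four_point : ∀ x y z w,
    d x y + d z w ≤ d x z + d y w + D ∨ d x y + d z w ≤ d x w + d y z + D

namespace SimpleGraph

variable {G : Type*} [Group G] (S : Set G)

lemma mulCayley_dist_mul_left_le (hc : (mulCayley S).Connected) (g x y : G) :
    (mulCayley S).dist (g * x) (g * y) ≤ (mulCayley S).dist x y := by
  obtain ⟨w, hw⟩ := hc.exists_walk_length_eq_dist x y
  let f : mulCayley S →g mulCayley S := ⟨(g * ·), fun h => mulCayley_adj_mul_iff_right.2 h⟩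
  rw [← hw, ← w.length_map f]
  exact dist_le (w.map f)

lemma mulCayley_connected (hS : Subgroup.closure S = ⊤) : (mulCayley S).Connected := by
  have h1 : ∀ g : G, (mulCayley S).Reachable 1 g := by
    intro g
    have hg : g ∈ Subgroup.closure S := hS ▸ Subgroup.mem_top g
    have hadj : ∀ x s : G, s ∈ S → (mulCayley S).Reachable x (x * s) := by
      intro x s hs
      by_cases h : x = x * s
      · rw [← h]
      · exact Adj.reachable ((mulCayley_adj' _ _ _).2 ⟨h, s, hs, Or.inl rfl⟩)
    induction hg using Subgroup.closure_induction_right with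
    | one => exact Reachable.refl _
    | mul_right x hx y hy ih => exact ih.trans (hadj x y hy)
    | mul_inv_cancel x hx y hy ih =>
      have := hadj (x * y⁻¹) y hy
      rw [inv_mul_cancel_right] at this
      exact ih.trans this.symm
  exact (connected_iff _).2 ⟨fun x y => (h1 x).symm.trans (h1 y), ⟨1⟩⟩

lemma mulCayley_finite_ball (hS : S.Finite) (hc : (mulCayley S).Connected) (n : ℕ) :
    {g | (mulCayley S).dist 1 g ≤ n}.Finite := by
  induction n with
  | zero =>
    refine (Set.finite_singleton (1 : G)).subset fun g hg => ?_
    simpa [hc.dist_eq_zero_iff, eq_comm] using hg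
  | succ n ih =>
    refine (ih.union ((Set.Finite.mul ih hS).union (Set.Finite.mul ih hS.inv))).subset ?_
    intro g hg
    obtain ⟨w, hw⟩ := hc.exists_walk_length_eq_dist g 1
    cases w with
    | nil => exact Or.inl (by simp)
    | @cons _ b _ hgb w =>
      have hb : (mulCayley S).dist 1 b ≤ n := by
        rw [dist_comm]
        refine (dist_le w).trans ?_
        rw [dist_comm, Walk.length_cons] at hw
        have : (mulCayley S).dist 1 g ≤ n + 1 := hg
        omega
      obtain ⟨-, s, hs, h | h⟩ := (mulCayley_adj' _ _ _).1 hgb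
      · exact Or.inr (Or.inr ⟨b, hb, s⁻¹, by simpa using hs, by simp [← h]⟩)
      · exact Or.inr (Or.inl ⟨b, hb, s, hs, h.symm⟩)

end SimpleGraph

lemma IsHyperbolicGroup.exists_wordMetric {G : Type u} [Group G] (h : IsHyperbolicGroup G) :
    ∃ (d : G → G → ℕ) (D : ℕ), IsHyperbolicWordMetric d D := by
  obtain ⟨S, hS, δ, hδ⟩ := h
  have hc := SimpleGraph.mulCayley_connected (S : Set G) hS
  refine ⟨(SimpleGraph.mulCayley (S : Set G)).dist, 2 * δ, ?_⟩
  constructor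
  · simp
  · exact fun x y => SimpleGraph.dist_comm
  · exact fun x y z => hc.dist_triangle
  · intro g x y
    refine le_antisymm (SimpleGraph.mulCayley_dist_mul_left_le _ hc _ _ _) ?_
    simpa using SimpleGraph.mulCayley_dist_mul_left_le _ hc g⁻¹ (g * x) (g * y)
  · exact SimpleGraph.mulCayley_finite_ball _ S.finite_toSet hc
  · intro x y s hs
    obtain ⟨w, hw⟩ := hc.exists_walk_length_eq_dist x y
    have h1 := SimpleGraph.dist_le (w.take s)
    have h2 := SimpleGraph.dist_le (w.drop s)
    have h3 := hc.dist_triangle (u := x) (v := w.getVert s) (w := y)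
    rw [SimpleGraph.Walk.take_length] at h1
    rw [SimpleGraph.Walk.drop_length] at h2
    exact ⟨w.getVert s, by omega, by omega⟩
  · intro x y z w
    have := hδ x y z w
    dsimp only at this
    rcases max_choice ((SimpleGraph.mulCayley (S : Set G)).dist x z +
      (SimpleGraph.mulCayley (S : Set G)).dist y w) ((SimpleGraph.mulCayley (S : Set G)).dist x w +
      (SimpleGraph.mulCayley (S : Set G)).dist y z) with h | h <;> rw [h] at this
    · exact Or.inl this
    · exact Or.inr this

namespace IsHyperbolicWordMetric

variable {G : Type*} [Group G] {d : G → G → ℕ} {D : ℕ}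

lemma dist_pow_pow (h : IsHyperbolicWordMetric d D) (c : G) (m n : ℕ) :
    d (c ^ m) (c ^ (m + n)) = d 1 (c ^ n) := by
  have := h.mul_left (c ^ m) 1 (c ^ n)
  rwa [mul_one, ← pow_add] at this

/-- The powers of an element of infinite order do not grow logarithmically. Otherwise, for a
power `c ^ N` that is longer than all the preceding ones, the midpoint of a geodesic from `1` to
`c ^ N` would be moved only a bounded amount by many powers of `c`. -/
lemma exists_dist_pow_two_mul (h : IsHyperbolicWordMetric d D) {c : G} (hc : ¬ IsOfFinOrder c)
    (C : ℕ) : ∃ M, 1 ≤ M ∧ d 1 (c ^ M) + C < d 1 (c ^ (2 * M)) := by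
  by_contra! hcon
  have hinj : Function.Injective fun n : ℕ => c ^ n := injective_pow_iff_not_isOfFinOrder.2 hc
  have hB := h.finite_ball (3 * D)
  set I := hB.toFinset.card with hI
  obtain ⟨A, hA⟩ : ∃ A, ∀ i ≤ I, d 1 (c ^ i) ≤ A :=
    ⟨(Finset.range (I + 1)).sup fun i => d 1 (c ^ i), fun i hi =>
      Finset.le_sup (f := fun i => d 1 (c ^ i)) (Finset.mem_range.2 (by omega))⟩
  have hunb : ∃ n : ℕ, A + C + 2 ≤ d 1 (c ^ n) := by
    by_contra! hb
    exact Set.infinite_range_of_injective hinj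
      ((h.finite_ball (A + C + 2)).subset (by rintro _ ⟨n, rfl⟩; exact (hb n).le))
  classical
  set N := Nat.find hunb with hN
  have hN1 : A + C + 2 ≤ d 1 (c ^ N) := Nat.find_spec hunb
  have hN2 : ∀ j < N, d 1 (c ^ j) < A + C + 2 := fun j hj => not_le.1 (Nat.find_min hunb hj)
  have hIN : I < N := by
    by_contra hle
    have := hA N (by omega)
    omega
  obtain ⟨p, hp1, hp2⟩ := h.geodesic 1 (c ^ N) (d 1 (c ^ N) / 2) (by omega)
  have key : ∀ i ≤ I, d 1 (p⁻¹ * c ^ i * p) ≤ 3 * D := by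
    intro i hi
    have hai := hA i hi
    have e1 : d (c ^ i) (c ^ N) = d 1 (c ^ (N - i)) := by
      rw [← h.dist_pow_pow c i (N - i), Nat.add_sub_cancel' (by omega)]
    have e2 : d (c ^ N) (c ^ (N + i)) = d 1 (c ^ i) := h.dist_pow_pow c N i
    have e3 : d (c ^ N) (c ^ (2 * N)) = d 1 (c ^ N) := by rw [two_mul]; exact h.dist_pow_pow c N N
    have e4 : d (c ^ (N + i)) (c ^ (2 * N)) = d 1 (c ^ (N - i)) := by
      rw [← h.dist_pow_pow c (N + i) (N - i)]; congr 2; omega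
    have e5 : d (c ^ i) (c ^ (N + i)) = d 1 (c ^ N) := by
      rw [add_comm]; exact h.dist_pow_pow c i N
    have e6 : d (c ^ i) (c ^ i * p) = d 1 p := by simpa using h.mul_left (c ^ i) 1 p
    have e7 : d (c ^ i * p) (c ^ (N + i)) = d p (c ^ N) := by
      rw [add_comm, pow_add]; exact h.mul_left _ _ _
    have e8 : d 1 (p⁻¹ * c ^ i * p) = d p (c ^ i * p) := by
      simpa [mul_assoc] using (h.mul_left p 1 (p⁻¹ * c ^ i * p)).symm
    have hNi : d 1 (c ^ (N - i)) ≤ d 1 (c ^ N) := by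
      rcases Nat.eq_zero_or_pos i with rfl | hpos
      · simp
      · have := hN2 (N - i) (by omega)
        omega
    have h2N := hcon N (by omega)
    have q1 := h.four_point 1 (c ^ (N + i)) (c ^ N) (c ^ (2 * N))
    have q2 := h.four_point p (c ^ i) 1 (c ^ N)
    have q3 := h.four_point p (c ^ (N + i)) 1 (c ^ N)
    have q4 := h.four_point p (c ^ i * p) (c ^ i) (c ^ (N + i))
    have s1 := h.comm (c ^ (N + i)) (c ^ N)
    have s2 := h.comm p 1
    have s3 := h.comm (c ^ i) 1
    have s4 := h.comm (c ^ (N + i)) 1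
    have s5 := h.comm (c ^ i * p) (c ^ i)
    rw [e8]
    omega
  have hcard : (Finset.range (I + 1)).card ≤ hB.toFinset.card := by
    refine Finset.card_le_card_of_injOn (fun i => p⁻¹ * c ^ i * p) ?_ ?_
    · intro i hi
      have := key i (by simpa [Nat.lt_succ_iff] using hi)
      simpa using this
    · intro i _ j _ hij
      simp only [mul_left_inj, mul_right_inj] at hij
      exact hinj hij
  rw [Finset.card_range] at hcard
  omega

variable {c : G}

/-- If the square of an element is sufficiently longer than the element, then its powers get
longer linearly (local quasigeodesics are quasigeodesics). -/
lemma dist_pow_succ (h : IsHyperbolicWordMetric d D) (hc : d 1 c + 2 * D + 1 ≤ d 1 (c ^ 2))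
    (n : ℕ) : d 1 (c ^ n) + D + 1 ≤ d 1 (c ^ (n + 1)) := by
  have h1 : d 1 (c ^ 2) ≤ d 1 c + d 1 c := by
    have := h.triangle 1 c (c ^ 2)
    have e := h.dist_pow_pow c 1 1
    norm_num at e
    omega
  induction n with
  | zero =>
    have := h.self 1
    simp only [pow_zero, zero_add, pow_one]
    omega
  | succ n ih =>
    have q := h.four_point 1 (c ^ (n + 1)) (c ^ n) (c ^ (n + 2))
    have e1 : d (c ^ n) (c ^ (n + 2)) = d 1 (c ^ 2) := h.dist_pow_pow c n 2
    have e2 : d (c ^ (n + 1)) (c ^ (n + 2)) = d 1 c := by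
      simpa using h.dist_pow_pow c (n + 1) 1
    have e3 : d (c ^ n) (c ^ (n + 1)) = d 1 c := by simpa using h.dist_pow_pow c n 1
    have s1 := h.comm (c ^ (n + 1)) (c ^ n)
    rw [show n + 1 + 1 = n + 2 from rfl]
    omega

lemma dist_pow_add (h : IsHyperbolicWordMetric d D) (hc : d 1 c + 2 * D + 1 ≤ d 1 (c ^ 2))
    (m n : ℕ) : d 1 (c ^ m) + d 1 (c ^ n) ≤ d 1 (c ^ (m + n)) + (d 1 c + D) := by
  cases n with
  | zero =>
    have := h.self 1
    simp only [pow_zero, add_zero]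
    omega
  | succ n =>
    have q := h.four_point 1 (c ^ (m + 1)) (c ^ m) (c ^ (m + (n + 1)))
    have e1 : d (c ^ m) (c ^ (m + (n + 1))) = d 1 (c ^ (n + 1)) := h.dist_pow_pow c m (n + 1)
    have e2 : d (c ^ (m + 1)) (c ^ (m + (n + 1))) = d 1 (c ^ n) := by
      rw [← h.dist_pow_pow c (m + 1) n]; congr 2; omega
    have e3 : d (c ^ m) (c ^ (m + 1)) = d 1 c := by simpa using h.dist_pow_pow c m 1
    have s1 := h.comm (c ^ (m + 1)) (c ^ m)
    have := h.dist_pow_succ hc m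
    have := h.dist_pow_succ hc n
    omega

lemma le_dist_pow (h : IsHyperbolicWordMetric d D) (hc : d 1 c + 2 * D + 1 ≤ d 1 (c ^ 2))
    (n : ℕ) : n ≤ d 1 (c ^ n) := by
  induction n with
  | zero => exact Nat.zero_le _
  | succ n ih =>
    have := h.dist_pow_succ hc n
    omega

/-- If `t` conjugates a power of `c` to a power of `c`, then the lines `⟨c⟩` and `t⟨c⟩` stay at
bounded distance from each other; they are quasigeodesics, so that this distance is bounded
independently of `t`. -/
lemma exists_dist_zpow_le (h : IsHyperbolicWordMetric d D)
    (hc : d 1 c + 2 * D + 1 ≤ d 1 (c ^ 2)) {t : G} {p q : ℤ} (hp : p ≠ 0)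
    (hpq : t * c ^ p = c ^ q * t) : ∃ j : ℤ, d t (c ^ j) ≤ 3 * d 1 c + 5 * D := by
  have hz : ∀ i : ℤ, d 1 (c ^ i) = d 1 (c ^ i.natAbs) := by
    intro i
    rcases Int.natAbs_eq i with hi | hi
    · conv_lhs => rw [hi, zpow_natCast]
    · conv_lhs => rw [hi, zpow_neg, zpow_natCast]
      have := h.mul_left (c ^ i.natAbs) 1 (c ^ i.natAbs)⁻¹
      rw [mul_one, mul_inv_cancel] at this
      rw [← this, h.comm]
  have hzz : ∀ i j : ℤ, d (c ^ i) (c ^ j) = d 1 (c ^ (j - i).natAbs) := by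
    intro i j
    rw [← hz, ← h.mul_left (c ^ i) 1, mul_one, ← zpow_add, add_sub_cancel]
  have hpk : ∀ k : ℤ, t * c ^ (p * k) = c ^ (q * k) * t := by
    intro k
    have h1 : t * c ^ p * t⁻¹ = c ^ q := by rw [hpq, mul_inv_cancel_right]
    have h2 : (t * c ^ p * t⁻¹) ^ k = c ^ (q * k) := by rw [h1, zpow_mul]
    rw [conj_zpow, ← zpow_mul] at h2
    rw [← h2, inv_mul_cancel_right]
  set k : ℕ := 2 * d 1 t + d 1 c + 3 * D + 1 with hk
  set n : ℕ := (q * k).natAbs with hn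
  -- the endpoints of a long segment of the line of `c`
  obtain ⟨X, Y, hXY⟩ : ∃ i j : ℤ, (i = -n ∧ j = n) ∧ ((i = -(q * k) ∧ j = q * k) ∨
      (i = q * k ∧ j = -(q * k))) := ⟨-n, n, ⟨rfl, rfl⟩, by omega⟩
  have hu : k ≤ d 1 (c ^ (p * k).natAbs) := by
    refine le_trans ?_ (h.le_dist_pow hc _)
    rw [Int.natAbs_mul, Int.natAbs_natCast]
    exact Nat.le_mul_of_pos_left _ (Int.natAbs_pos.2 hp)
  set m := (p * k).natAbs with hm
  set u := d 1 (c ^ m) with hu'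
  have h2u := h.dist_pow_add hc m m
  have hprod : d t (c ^ (-(q * k))) + d t (c ^ (q * k)) ≤
      d (c ^ (-(q * k))) (c ^ (q * k)) + (d 1 c + 3 * D) := by
    have t1 : d (c ^ (q * k)) (t * c ^ (p * k)) = d 1 t := by
      rw [hpk]; simpa using h.mul_left (c ^ (q * (k : ℤ))) 1 t
    have t2 : d (c ^ (-(q * k))) (t * c ^ (-(p * k))) = d 1 t := by
      have := hpk (-k)
      rw [mul_neg, mul_neg] at this
      rw [this]; simpa using h.mul_left (c ^ (-(q * (k : ℤ)))) 1 t
    have t3 : d t (t * c ^ (p * k)) = u := by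
      rw [hu', hm, ← hz]; simpa using h.mul_left t 1 (c ^ (p * (k : ℤ)))
    have t4 : d t (t * c ^ (-(p * k))) = u := by
      have := hz (-(p * k))
      rw [Int.natAbs_neg] at this
      rw [hu', hm, ← this]; simpa using h.mul_left t 1 (c ^ (-(p * (k : ℤ))))
    have t5 : d (t * c ^ (-(p * k))) (t * c ^ (p * k)) = d 1 (c ^ (m + m)) := by
      rw [h.mul_left, hzz]; congr 2; omega
    have q1 := h.four_point t (c ^ (-(q * k))) (t * c ^ (-(p * k))) (t * c ^ (p * k))
    have q2 := h.four_point t (c ^ (q * k)) (c ^ (-(q * k))) (t * c ^ (p * k))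
    have r1 := h.triangle t (c ^ (-(q * k))) (t * c ^ (-(p * k)))
    have r2 := h.triangle t (c ^ (q * k)) (t * c ^ (p * k))
    have s1 := h.comm (c ^ (q * k)) (c ^ (-(q * k)))
    omega
  have hprod' : d t (c ^ X) + d t (c ^ Y) ≤ d 1 (c ^ (2 * n)) + (d 1 c + 3 * D) := by
    have : d (c ^ (-(q * k))) (c ^ (q * k)) = d 1 (c ^ (2 * n)) := by
      rw [hzz]; congr 2; omega
    rcases hXY.2 with ⟨h1, h2⟩ | ⟨h1, h2⟩ <;> rw [h1, h2] <;> omega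
  -- the point of this segment whose distance to the endpoint is about that of `t`
  obtain ⟨j, hj, hj1, hj2⟩ : ∃ j ≤ 2 * n, d 1 (c ^ j) ≤ d t (c ^ X) ∧
      d t (c ^ X) ≤ d 1 (c ^ j) + (d 1 c + 3 * D) := by
    by_cases hlt : d 1 (c ^ (2 * n)) ≤ d t (c ^ X)
    · exact ⟨2 * n, le_rfl, hlt, by omega⟩
    · classical
      have hex : ∃ i, d t (c ^ X) < d 1 (c ^ i) := ⟨2 * n, not_le.1 hlt⟩
      have hf := Nat.find_spec hex
      have hle : Nat.find hex ≤ 2 * n := Nat.find_min' hex (not_le.1 hlt)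
      cases hi : Nat.find hex with
      | zero =>
        rw [hi, pow_zero, h.self] at hf
        omega
      | succ i =>
        have hmin := Nat.find_min hex (m := i) (by omega)
        rw [hi] at hf
        refine ⟨i, by omega, by omega, ?_⟩
        have := h.triangle 1 (c ^ i) (c ^ (i + 1))
        have e := h.dist_pow_pow c i 1
        rw [pow_one] at e
        omega
  refine ⟨X + j, ?_⟩
  have q1 := h.four_point t (c ^ (X + j)) (c ^ X) (c ^ Y)
  have e1 : d (c ^ X) (c ^ Y) = d 1 (c ^ (2 * n)) := by rw [hzz]; congr 2; omega
  have e2 : d (c ^ (X + j)) (c ^ X) = d 1 (c ^ j) := by rw [hzz]; congr 2; omega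
  have e3 : d (c ^ (X + j)) (c ^ Y) = d 1 (c ^ (2 * n - j)) := by rw [hzz]; congr 2; omega
  have e4 := h.dist_pow_add hc j (2 * n - j)
  rw [Nat.add_sub_cancel' hj] at e4
  omega

end IsHyperbolicWordMetric

/-- In a hyperbolic group, the elements conjugating a nontrivial power of a given element `c` of
infinite order to another one lie in finitely many cosets of `⟨c⟩`. -/
theorem IsHyperbolicGroup.exists_finite_commensurator {G : Type u} [Group G]
    (h : IsHyperbolicGroup G) {c : G} (hc : ¬ IsOfFinOrder c) :
    ∃ F : Set G, F.Finite ∧ ∀ (t : G) (p q : ℤ), q ≠ 0 → t * c ^ p = c ^ q * t →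
      ∃ j : ℤ, t * c ^ j ∈ F := by
  obtain ⟨d, D, hd⟩ := h.exists_wordMetric
  obtain ⟨M, hM, hM2⟩ := hd.exists_dist_pow_two_mul hc (2 * D)
  have hc' : d 1 (c ^ M) + 2 * D + 1 ≤ d 1 ((c ^ M) ^ 2) := by
    rw [← pow_mul, mul_comm M 2]; omega
  refine ⟨_, hd.finite_ball (3 * d 1 (c ^ M) + 5 * D), fun t p q hq hpq => ?_⟩
  have h1 : t⁻¹ * (c ^ M) ^ q = (c ^ M) ^ p * t⁻¹ := by
    have h2 : t * c ^ p * t⁻¹ = c ^ q := by rw [hpq, mul_inv_cancel_right]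
    have h3 : (t * c ^ p * t⁻¹) ^ M = c ^ (q * M) := by rw [h2, zpow_mul, zpow_natCast]
    rw [conj_pow, ← zpow_natCast, ← zpow_mul] at h3
    rw [← zpow_natCast c M, ← zpow_mul, ← zpow_mul, mul_comm (M : ℤ) q, mul_comm (M : ℤ) p, ← h3]
    group
  obtain ⟨j, hj⟩ := hd.exists_dist_zpow_le hc' hq h1
  refine ⟨M * j, ?_⟩
  have h2 := hd.mul_left t t⁻¹ ((c ^ M) ^ j)
  rw [mul_inv_cancel] at h2
  rw [Set.mem_ofPred_eq, zpow_mul, zpow_natCast, h2]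
  exact hj

/-! ### Free groups as free products with an infinite cyclic factor -/

/-- A decomposition of a group `F` as a free product `B * ⟨t⟩`, recorded through the set `side` of
the elements whose reduced word starts with `t`, and through the exponent `χ` of `t`. -/
structure FreeCut (F : Type*) [Group F] where
  /-- The complementary free factor. -/
  B : Subgroup F
  /-- The generator of the cyclic free factor. -/
  t : F
  /-- The exponent sum of `t`. -/
  χ : F →* Multiplicative ℤ
  /-- The elements whose reduced word starts with `t`. -/
  side : F → Prop
  side_mul : ∀ g, ∀ b ∈ B, side (g * b) ↔ side g
  side_mul_t : ∀ g, g ≠ 1 → (side (g * t) ↔ side g)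
  side_one : ¬ side 1
  side_t : side t
  closure_eq : Subgroup.closure ((B : Set F) ∪ {t}) = ⊤
  χ_B : ∀ b ∈ B, χ b = 1
  χ_t : χ t = Multiplicative.ofAdd 1
  exists_not_isOfFinOrder : ∃ b ∈ B, ¬ IsOfFinOrder b

namespace FreeGroup

variable {X : Type*} [DecidableEq X]

/-- Multiplication by a letter on the left keeps the property of a reduced word to end with a given
letter, apart from the case in which this letter appears in or disappears from a word of length at
most one. -/
lemma getLast?_toWord_mk_mul {x y : X} {c b : Bool} (h : FreeGroup X)
    (h0 : (y, b) = (x, c) → h ≠ 1) (h1 : (y, !b) = (x, c) → False) :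
    (toWord (mk [(y, b)] * h)).getLast? = some (x, c) ↔ (toWord h).getLast? = some (x, c) := by
  have hw : toWord (mk [(y, b)] * h) = reduce ((y, b) :: toWord h) := by
    conv_lhs => rw [← mk_toWord (x := h), mul_mk, toWord_mk, List.singleton_append]
  rw [hw, reduce.cons, reduce_toWord]
  rcases hh : toWord h with _ | ⟨⟨z, e⟩, tl⟩
  · simp only [List.getLast?_singleton, Option.some.injEq, List.getLast?_nil, reduceCtorEq,
      iff_false]
    exact fun hy => h0 hy (toWord_eq_nil_iff.1 hh)
  · dsimp only
    split_ifs with hc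
    · cases tl with
      | nil =>
        obtain ⟨rfl, rfl⟩ := hc
        simp only [List.getLast?_singleton, Option.some.injEq, List.getLast?_nil, reduceCtorEq,
          false_iff]
        simpa using h1
      | cons a tl => simp [List.getLast?_cons_cons]
    · simp [List.getLast?_cons_cons]

end FreeGroup

lemma FreeGroup.nonempty_freeCut {X : Type*} {x₀ x₁ : X} (hx : x₁ ≠ x₀) :
    Nonempty (FreeCut (FreeGroup X)) := by
  classical
  set B : Subgroup (FreeGroup X) := Subgroup.closure (FreeGroup.of '' {x | x ≠ x₀})
  have key := @FreeGroup.getLast?_toWord_mk_mul X _ x₀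
  refine ⟨{ B := B
            t := FreeGroup.of x₀
            χ := FreeGroup.lift fun x => if x = x₀ then Multiplicative.ofAdd 1 else 1
            side := fun g => (FreeGroup.toWord g⁻¹).getLast? = some (x₀, false)
            side_mul := ?_
            side_mul_t := ?_
            side_one := by simp
            side_t := by simp [FreeGroup.toWord_inv, FreeGroup.invRev]
            closure_eq := ?_
            χ_B := ?_
            χ_t := by simp
            exists_not_isOfFinOrder := ?_ }⟩
  · intro g b hb
    induction hb using Subgroup.closure_induction generalizing g with
    | mem b hb =>
      obtain ⟨x, hx, rfl⟩ := hb
      rw [mul_inv_rev]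
      exact key (y := x) (b := false) g⁻¹ (by simp [show x ≠ x₀ from hx])
        (by simp)
    | one => rw [mul_one]
    | mul a b _ _ iha ihb => rw [← mul_assoc, ihb, iha]
    | inv b _ ih => rw [← ih (g * b⁻¹), inv_mul_cancel_right]
  · intro g hg
    rw [mul_inv_rev]
    exact key (y := x₀) (b := false) g⁻¹ (by simpa using hg) (by simp)
  · rw [eq_top_iff, ← FreeGroup.closure_range_of, Subgroup.closure_le]
    rintro _ ⟨x, rfl⟩
    by_cases h : x = x₀
    · exact Subgroup.subset_closure (Or.inr (by rw [h]; rfl))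
    · exact Subgroup.subset_closure (Or.inl (Subgroup.subset_closure ⟨x, h, rfl⟩))
  · intro b hb
    induction hb using Subgroup.closure_induction with
    | mem b hb =>
      obtain ⟨x, hx, rfl⟩ := hb
      simp [show x ≠ x₀ from hx]
    | one => simp
    | mul a b _ _ iha ihb => rw [_root_.map_mul, iha, ihb, mul_one]
    | inv b _ ih => rw [_root_.map_inv, ih, inv_one]
  · refine ⟨_, Subgroup.subset_closure ⟨x₁, hx, rfl⟩, ?_⟩
    intro h
    obtain ⟨n, hn, h⟩ := isOfFinOrder_iff_pow_eq_one.1 h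
    have := congrArg FreeGroup.norm h
    rw [FreeGroup.norm_of_pow, FreeGroup.norm_one] at this
    omega

/-- A nonabelian free group splits off an infinite cyclic free factor whose complement is not
trivial. -/
lemma IsFreeGroup.nonempty_freeCut {F : Type u} [Group F] (hF : IsFreeGroup F)
    (hna : ∃ a b : F, a * b ≠ b * a) : Nonempty (FreeCut F) := by
  set e := IsFreeGroup.toFreeGroup F
  obtain ⟨x₀, x₁, hx⟩ : ∃ x₀ x₁ : IsFreeGroup.Generators F, x₁ ≠ x₀ := by
    by_contra! hcon
    obtain ⟨a, b, hab⟩ := hna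
    apply hab
    apply e.injective
    rw [map_mul, map_mul]
    have hcomm : ∀ y z : FreeGroup (IsFreeGroup.Generators F), y * z = z * y := by
      have hle : Subgroup.closure (Set.range FreeGroup.of) ≤
          Subgroup.center (FreeGroup (IsFreeGroup.Generators F)) := by
        rw [Subgroup.closure_le]
        rintro _ ⟨x, rfl⟩
        rw [SetLike.mem_coe, Subgroup.mem_center_iff]
        intro g
        have hg : g ∈ Subgroup.closure (Set.range (FreeGroup.of :
            IsFreeGroup.Generators F → _)) := by
          rw [FreeGroup.closure_range_of]; trivial
        induction hg using Subgroup.closure_induction with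
        | mem b hb =>
          obtain ⟨y, rfl⟩ := hb
          rw [hcon x y]
        | one => simp
        | mul a b _ _ iha ihb => rw [mul_assoc, ihb, ← mul_assoc, iha, mul_assoc]
        | inv b _ ih => rw [inv_mul_eq_iff_eq_mul, ← mul_assoc, ih, mul_inv_cancel_right]
      rw [FreeGroup.closure_range_of] at hle
      exact fun y z => (Subgroup.mem_center_iff.1 (hle (Subgroup.mem_top z)) y)
    exact hcomm _ _
  obtain ⟨c⟩ := FreeGroup.nonempty_freeCut hx
  refine ⟨{ B := c.B.comap e.toMonoidHom
            t := e.symm c.t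
            χ := c.χ.comp e.toMonoidHom
            side := fun g => c.side (e g)
            side_mul := fun g b hb => by rw [map_mul]; exact c.side_mul _ _ hb
            side_mul_t := fun g hg => by
              rw [map_mul, e.apply_symm_apply]
              exact c.side_mul_t _ (by simpa using hg)
            side_one := by rw [map_one]; exact c.side_one
            side_t := by rw [e.apply_symm_apply]; exact c.side_t
            closure_eq := ?_
            χ_B := fun b hb => c.χ_B _ hb
            χ_t := by simp [c.χ_t]
            exists_not_isOfFinOrder := ?_ }⟩
  · have h := congrArg (Subgroup.map e.symm.toMonoidHom) c.closure_eq
    rw [MonoidHom.map_closure, Subgroup.map_top_of_surjective _ e.symm.surjective] at h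
    rw [← h]
    congr 1
    ext g
    simp only [Set.mem_union, SetLike.mem_coe, Set.mem_singleton_iff, Set.mem_image]
    constructor
    · rintro (h | rfl)
      · exact ⟨e g, Or.inl h, by simp⟩
      · exact ⟨c.t, Or.inr rfl, rfl⟩
    · rintro ⟨y, h | rfl, rfl⟩
      · exact Or.inl (by simpa using h)
      · exact Or.inr rfl
  · obtain ⟨b, hb, hb'⟩ := c.exists_not_isOfFinOrder
    refine ⟨e.symm b, by simpa using hb, fun h => hb' ?_⟩
    simpa using e.toMonoidHom.isOfFinOrder h

/-! ### Nonabelian free groups have several ends -/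

/-- The powers of an element of infinite order converge to an end of the Cayley graph. -/
lemma exists_end_of_not_isOfFinOrder {G : Type u} [Group G] {S : Set G}
    (hS : Subgroup.closure S = ⊤) {g : G} (hg : ¬ IsOfFinOrder g) :
    ∃ s ∈ (SimpleGraph.mulCayley S).end, ∀ K : (Finset G)ᵒᵖ, ∃ N : ℕ, ∀ n ≥ N,
      ∃ h : g ^ n ∉ K.unop, s K = (SimpleGraph.mulCayley S).componentComplMk h := by
  have hinj : Function.Injective fun n : ℕ => g ^ n := injective_pow_iff_not_isOfFinOrder.2 hg
  obtain ⟨w⟩ := (SimpleGraph.mulCayley_connected S hS).preconnected 1 g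
  have key : ∀ K : (Finset G)ᵒᵖ, ∃ C : (SimpleGraph.mulCayley S).ComponentCompl K.unop,
      ∃ N : ℕ, ∀ n ≥ N, ∃ h : g ^ n ∉ K.unop,
        C = (SimpleGraph.mulCayley S).componentComplMk h := by
    intro K
    have hfin : {n : ℕ | ∃ x ∈ w.support, g ^ n * x ∈ K.unop}.Finite := by
      have : {n : ℕ | ∃ x ∈ w.support, g ^ n * x ∈ K.unop} =
          ⋃ x ∈ {x | x ∈ w.support}, {n : ℕ | g ^ n * x ∈ K.unop} := by
        ext n; simp
      rw [this]
      refine Set.Finite.biUnion (List.finite_toSet _) fun x _ => ?_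
      exact Set.Finite.preimage (f := fun n : ℕ => g ^ n * x)
        (fun a _ b _ hab => hinj (mul_right_cancel hab)) K.unop.finite_toSet
    obtain ⟨N, hN⟩ := hfin.bddAbove
    have hN' : ∀ n, N + 1 ≤ n → ∀ x ∈ w.support, g ^ n * x ∉ K.unop := by
      intro n hn x hx hK
      have : n ≤ N := hN ⟨x, hx, hK⟩
      omega
    have hout : ∀ n, N + 1 ≤ n → g ^ n ∉ K.unop := fun n hn => by
      simpa using hN' n hn 1 w.start_mem_support
    refine ⟨(SimpleGraph.mulCayley S).componentComplMk (hout (N + 1) le_rfl), N + 1, ?_⟩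
    intro n hn
    refine ⟨hout n hn, ?_⟩
    induction n, hn using Nat.le_induction with
    | base => rfl
    | succ n hn ih =>
      rw [ih, SimpleGraph.ConnectedComponent.eq]
      let f : SimpleGraph.mulCayley S →g SimpleGraph.mulCayley S :=
        ⟨(g ^ n * ·), fun h => SimpleGraph.mulCayley_adj_mul_iff_right.2 h⟩
      have hw : ∀ x ∈ (w.map f).support, x ∈ ((K.unop : Set G))ᶜ := by
        intro x hx
        rw [SimpleGraph.Walk.support_map, List.mem_map] at hx
        obtain ⟨y, hy, rfl⟩ := hx
        exact hN' n hn y hy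
      have := ((w.map f).induce _ hw).reachable
      convert this using 2
      · exact (mul_one _).symm
      · exact pow_succ g n
  choose s N hs using key
  refine ⟨s, ?_, fun K => ⟨N K, hs K⟩⟩
  intro K L f
  obtain ⟨h1, e1⟩ := hs K (max (N K) (N L)) (le_max_left _ _)
  obtain ⟨h2, e2⟩ := hs L (max (N K) (N L)) (le_max_right _ _)
  rw [e1, e2]
  rfl

namespace FreeCut

variable {F : Type u} [Group F] (c : FreeCut F)

lemma not_side_of_mem {b : F} (hb : b ∈ c.B) : ¬ c.side b := by
  have := c.side_mul 1 b hb
  rw [one_mul] at this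
  exact fun h => c.side_one (this.1 h)

lemma t_notMem : c.t ∉ c.B := fun h => c.not_side_of_mem h c.side_t

lemma χ_t_pow_ne_one {n : ℤ} (hn : n ≠ 0) : c.χ (c.t ^ n) ≠ 1 := by
  rw [map_zpow, c.χ_t, ← ofAdd_zsmul]
  simpa using hn

lemma side_t_pow (n : ℕ) : c.side (c.t ^ (n + 1)) := by
  induction n with
  | zero => simpa using c.side_t
  | succ n ih =>
    rw [pow_succ, c.side_mul_t]
    · exact ih
    · intro h
      apply c.χ_t_pow_ne_one (n := (n + 1 : ℕ)) (by omega)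
      rw [zpow_natCast, h, map_one]

/-- The set of the elements whose reduced word starts with `t` is almost invariant. -/
lemma finite_side_mul (s : F) : {g | ¬ (c.side (g * s) ↔ c.side g)}.Finite := by
  have hs : s ∈ Subgroup.closure ((c.B : Set F) ∪ {c.t}) := by rw [c.closure_eq]; trivial
  induction hs using Subgroup.closure_induction with
  | mem s hs =>
    rcases hs with hs | rfl
    · simp [c.side_mul _ s hs]
    · refine (Set.finite_singleton (1 : F)).subset fun g hg => ?_
      by_contra hne
      exact hg (c.side_mul_t g hne)
  | one => simp
  | mul a b _ _ iha ihb =>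
    refine (iha.union (ihb.preimage (f := fun g => g * a) (mul_left_injective a).injOn)).subset ?_
    intro g hg
    by_contra hcon
    simp only [Set.mem_union, Set.mem_ofPred_eq, Set.mem_preimage, not_or, not_not] at hcon hg
    rw [← mul_assoc] at hg
    exact hg (hcon.2.trans hcon.1)
  | inv a _ ih =>
    refine (ih.preimage (f := fun g => g * a⁻¹) (mul_left_injective _).injOn).subset ?_
    intro g hg hcon
    rw [inv_mul_cancel_right] at hcon
    exact hg hcon.symm

lemma not_isOneEndedGroup (c : FreeCut F) : ¬ IsOneEndedGroup F := by
  rintro ⟨S, hS, s, hs, huniq⟩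
  obtain ⟨b, hb, hb'⟩ := c.exists_not_isOfFinOrder
  have ht : ¬ IsOfFinOrder c.t := by
    intro h
    obtain ⟨n, hn, h⟩ := isOfFinOrder_iff_pow_eq_one.1 h
    apply c.χ_t_pow_ne_one (n := n) (by omega)
    rw [zpow_natCast, h, map_one]
  obtain ⟨s₁, hs₁, h₁⟩ := exists_end_of_not_isOfFinOrder hS ht
  obtain ⟨s₂, hs₂, h₂⟩ := exists_end_of_not_isOfFinOrder hS hb'
  obtain rfl := (huniq s₁ hs₁).trans (huniq s₂ hs₂).symm
  -- the finitely many vertices at which an edge leaves the almost invariant set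
  have hK : (⋃ s ∈ (S : Set F), {g | ¬ (c.side (g * s) ↔ c.side g)}).Finite :=
    S.finite_toSet.biUnion fun s _ => c.finite_side_mul s
  set K := hK.toFinset with hKdef
  have hmem : ∀ g ∉ K, ∀ s ∈ S, (c.side (g * s) ↔ c.side g) := by
    intro g hg s hs
    by_contra hcon
    exact hg (hK.mem_toFinset.2 (Set.mem_biUnion (Finset.mem_coe.2 hs) hcon))
  let side : (SimpleGraph.mulCayley (S : Set F)).ComponentCompl K → Prop :=
    SimpleGraph.ComponentCompl.lift (fun v _ => c.side v) (by
      intro v w hv hw hvw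
      obtain ⟨-, s, hs, rfl | rfl⟩ := (SimpleGraph.mulCayley_adj' _ _ _).1 hvw
      · exact propext (hmem _ hv s hs).symm
      · exact propext (hmem _ hw s hs))
  obtain ⟨N₁, hN₁⟩ := h₁ (Opposite.op K)
  obtain ⟨N₂, hN₂⟩ := h₂ (Opposite.op K)
  obtain ⟨k₁, e₁⟩ := hN₁ (N₁ + 1) (Nat.le_succ _)
  obtain ⟨k₂, e₂⟩ := hN₂ N₂ le_rfl
  have h := congrArg side (e₁.symm.trans e₂)
  have h' : c.side (c.t ^ (N₁ + 1)) = c.side (b ^ N₂) := h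
  exact c.not_side_of_mem (pow_mem hb N₂) (h' ▸ c.side_t_pow N₁)

end FreeCut

/-! ### Splittings: basic facts -/

namespace Splitting

variable {G : Type u} [Group G] (T : Splitting G)

/-- An element of the group as an automorphism of the tree. -/
def smulHom (g : G) : T.tree →g T.tree := ⟨(g • ·), fun h => T.smul_adj g _ _ h⟩

lemma dist_smul_le (g : G) (a b : T.V) : T.tree.dist (g • a) (g • b) ≤ T.tree.dist a b := by
  obtain ⟨w, hw⟩ := T.isTree.connected.exists_walk_length_eq_dist a b
  rw [← hw, ← w.length_map (T.smulHom g)]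
  exact SimpleGraph.dist_le (w.map (T.smulHom g))

lemma dist_smul (g : G) (a b : T.V) : T.tree.dist (g • a) (g • b) = T.tree.dist a b := by
  refine le_antisymm (T.dist_smul_le g a b) ?_
  simpa using T.dist_smul_le g⁻¹ (g • a) (g • b)

/-- An element which fixes two vertices fixes the path joining them. -/
lemma smul_getVert {a b : T.V} {w : T.tree.Walk a b} (hw : w.IsPath) {g : G} (ha : g • a = a)
    (hb : g • b = b) (i : ℕ) : g • w.getVert i = w.getVert i := by
  have ha' : T.smulHom g a = a := ha
  have hb' : T.smulHom g b = b := hb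
  have h1 : ((w.map (T.smulHom g)).copy ha' hb').IsPath := by
    rw [SimpleGraph.Walk.isPath_copy]
    exact hw.map (MulAction.injective g)
  have h2 := (T.isTree.existsUnique_path a b).unique h1 hw
  have h3 := congrArg (fun w => w.getVert i) h2
  simp only [SimpleGraph.Walk.getVert_copy, SimpleGraph.Walk.getVert_map] at h3
  exact h3

/-- The first edge on the way from one vertex to another. -/
lemma exists_adj_of_ne {a b : T.V} (hab : a ≠ b) : ∃ a', T.tree.Adj a a' ∧
    T.vertexGroup a ⊓ T.vertexGroup b ≤ T.vertexGroup a' ∧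
    T.tree.dist b a = T.tree.dist b a' + 1 := by
  obtain ⟨w, hw, hl⟩ := T.isTree.connected.exists_path_of_dist a b
  have hn : ¬ w.Nil := SimpleGraph.Walk.not_nil_of_ne hab
  refine ⟨w.snd, w.adj_snd hn, fun g hg => T.smul_getVert hw hg.1 hg.2 1, ?_⟩
  have h1 := SimpleGraph.dist_le w.tail
  have h2 := w.length_tail_add_one hn
  have h3 := T.isTree.connected.dist_triangle (u := a) (v := w.snd) (w := b)
  rw [SimpleGraph.dist_eq_one_iff_adj.2 (w.adj_snd hn)] at h3
  rw [SimpleGraph.dist_comm, SimpleGraph.dist_comm (u := b)]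
  omega

lemma vertexGroup_smul (g : G) (v : T.V) :
    T.vertexGroup (g • v) = (T.vertexGroup v).map (MulAut.conj g).toMonoidHom :=
  MulAction.stabilizer_smul_eq_stabilizer_map_conj g v

lemma isCyclic_vertexGroup_smul {g : G} {v : T.V} (h : IsCyclic (T.vertexGroup v)) :
    IsCyclic (T.vertexGroup (g • v)) := by
  rw [vertexGroup_smul]
  exact ((T.vertexGroup v).equivMapOfInjective _ (MulAut.conj g).injective).isCyclic.1 h

variable {T}

lemma IsCyclicSplitting.isCyclic_inf (hT : T.IsCyclicSplitting) {a b : T.V} (hab : a ≠ b) :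
    IsCyclic (T.vertexGroup a ⊓ T.vertexGroup b : Subgroup G) := by
  obtain ⟨a', ha, hle, -⟩ := T.exists_adj_of_ne hab
  have := (hT a a' ha).1
  exact Subgroup.isCyclic_of_le (le_inf inf_le_left hle)

/-- A vertex of a cyclic splitting whose group is not cyclic is not degenerate. -/
lemma IsCyclicSplitting.not_isDegenerate (hT : T.IsCyclicSplitting) {v : T.V}
    (hv : ¬ IsCyclic (T.vertexGroup v)) : ¬ T.IsDegenerate v := by
  rintro ⟨w, hvw, h⟩
  exact hv (h ▸ (hT v w hvw).1)

lemma vertexGroup_apply_of_injective {T' : Splitting G} (f : T'.V →[G] T.V)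
    (hf : Function.Injective f) (x : T'.V) : T.vertexGroup (f x) = T'.vertexGroup x := by
  ext g
  simp only [MulAction.mem_stabilizer_iff]
  rw [← map_smul, hf.eq_iff]

/-- If `g` fixes `a` but not the next vertex `a'` towards `b`, and `h` fixes `b` but not the next
vertex `b'` towards `a`, then `g * h` is hyperbolic. -/
lemma isHyperbolicElement_mul {a a' b b' : T.V} (haa' : T.tree.Adj a a') (hbb' : T.tree.Adj b b')
    (ha : T.tree.dist b a = T.tree.dist b a' + 1) (hb : T.tree.dist a b = T.tree.dist a b' + 1)
    {g h : G} (hga : g • a = a) (hga' : g • a' ≠ a') (hhb : h • b = b) (hhb' : h • b' ≠ b') :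
    T.IsHyperbolicElement (g * h) := by
  intro x hx
  have hT := T.isTree
  set y := h • x with hy
  have hgy : g • y = x := by rw [hy, ← mul_smul, hx]
  have e1 : T.tree.dist x a = T.tree.dist y a := by
    rw [← T.dist_smul g y a, hgy, hga]
  have e2 : T.tree.dist y b = T.tree.dist x b := by
    rw [← T.dist_smul h x b, hhb]
  have e3 : T.tree.dist x (g • a') = T.tree.dist y a' := by
    rw [← T.dist_smul g y a', hgy]
  have e4 : T.tree.dist y (h • b') = T.tree.dist x b' := T.dist_smul h x b'
  have hadj1 : T.tree.Adj (g • a') a := by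
    have := T.smul_adj g _ _ haa'.symm
    rwa [hga] at this
  have hadj2 : T.tree.Adj (h • b') b := by
    have := T.smul_adj h _ _ hbb'.symm
    rwa [hhb] at this
  have c1 : T.tree.dist a b = T.tree.dist b a := SimpleGraph.dist_comm
  have c2 : T.tree.dist a b' = T.tree.dist b' a := SimpleGraph.dist_comm
  rcases hT.dist_eq_dist_add_one_of_adj x hbb' with hxb | hxb
  · have hyb : T.tree.dist y b' = T.tree.dist y b + 1 := by
      rcases hT.dist_eq_dist_add_one_of_adj y hbb' with h1 | h1
      · exact absurd (hT.eq_of_dist_eq_add_one hadj2 hbb'.symm (by omega) h1) hhb'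
      · exact h1
    have h2 := hT.dist_eq_add_of_dist_eq_add_one hbb'.symm hb hyb
    have h3 := hT.connected.dist_triangle (u := x) (v := b') (w := a)
    omega
  · have h2 := hT.dist_eq_add_of_dist_eq_add_one hbb'.symm hb hxb
    have h3 := hT.connected.dist_triangle (u := x) (v := b) (w := a')
    have hxa : T.tree.dist x a = T.tree.dist x a' + 1 := by
      rcases hT.dist_eq_dist_add_one_of_adj x haa' with h1 | h1 <;> omega
    have hya : T.tree.dist y a' = T.tree.dist y a + 1 := by
      rcases hT.dist_eq_dist_add_one_of_adj y haa' with h1 | h1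
      · exact absurd (hT.eq_of_dist_eq_add_one (x := x) hadj1 haa'.symm (by omega) hxa) hga'
      · exact h1
    have h4 := hT.dist_eq_add_of_dist_eq_add_one haa'.symm ha hya
    omega

/-- If a vertex is moved by the group and its own group fixes no adjacent vertex, then there are
hyperbolic elements. -/
lemma exists_isHyperbolicElement {v : T.V} (hv : ∀ w, T.tree.Adj v w →
    ¬ T.vertexGroup v ≤ T.vertexGroup w) {s : G} (hs : s • v ≠ v) :
    ∃ g, T.IsHyperbolicElement g := by
  obtain ⟨a', haa', -, ha⟩ := T.exists_adj_of_ne hs.symm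
  obtain ⟨b', hbb', -, hb⟩ := T.exists_adj_of_ne hs
  obtain ⟨g, hg, hg'⟩ := SetLike.not_le_iff_exists.1 (hv a' haa')
  have hadj : T.tree.Adj v (s⁻¹ • b') := by
    simpa using T.smul_adj s⁻¹ _ _ hbb'
  obtain ⟨k, hk, hk'⟩ := SetLike.not_le_iff_exists.1 (hv _ hadj)
  refine ⟨g * (s * k * s⁻¹), isHyperbolicElement_mul haa' hbb' ha hb hg hg' ?_ ?_⟩
  · rw [mul_smul, inv_smul_smul, mul_smul, show k • v = v from hk]
  · intro h
    apply hk'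
    rw [MulAction.mem_stabilizer_iff, eq_inv_smul_iff, ← mul_smul, ← mul_smul]
    exact h

/-! ### Reduced splittings by collapsing edges -/

lemma smul_mem_orbit_iff {g : G} {x y : T.V} :
    g • x ∈ MulAction.orbit G y ↔ x ∈ MulAction.orbit G y := by
  rw [← MulAction.orbit_eq_iff, ← MulAction.orbit_eq_iff, MulAction.orbit_smul]

section collapse

variable (T) (x₀ y₀ : T.V)

open Classical in
/-- The map of the vertices that moves `g • x₀` to `g • y₀`. -/
noncomputable def collapseMap (x : T.V) : T.V :=
  if h : x ∈ MulAction.orbit G x₀ then h.choose • y₀ else x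

variable {T x₀ y₀}

lemma collapseMap_of_notMem {x : T.V} (h : x ∉ MulAction.orbit G x₀) :
    T.collapseMap x₀ y₀ x = x := dif_neg h

lemma collapseMap_smul_self (hle : T.vertexGroup x₀ ≤ T.vertexGroup y₀) (g : G) :
    T.collapseMap x₀ y₀ (g • x₀) = g • y₀ := by
  have h : g • x₀ ∈ MulAction.orbit G x₀ := ⟨g, rfl⟩
  rw [collapseMap, dif_pos h]
  have h1 : h.choose • x₀ = g • x₀ := h.choose_spec
  have h2 : g⁻¹ * h.choose ∈ T.vertexGroup y₀ :=
    hle (by rw [MulAction.mem_stabilizer_iff, mul_smul, h1, inv_smul_smul])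
  rw [MulAction.mem_stabilizer_iff, mul_smul, inv_smul_eq_iff] at h2
  exact h2

lemma collapseMap_smul (hle : T.vertexGroup x₀ ≤ T.vertexGroup y₀) (g : G) (x : T.V) :
    T.collapseMap x₀ y₀ (g • x) = g • T.collapseMap x₀ y₀ x := by
  by_cases h : x ∈ MulAction.orbit G x₀
  · obtain ⟨k, rfl⟩ := h
    dsimp only
    rw [← mul_smul, collapseMap_smul_self hle, collapseMap_smul_self hle, mul_smul]
  · rw [collapseMap_of_notMem h, collapseMap_of_notMem]
    rwa [smul_mem_orbit_iff]

lemma collapseMap_notMem (hle : T.vertexGroup x₀ ≤ T.vertexGroup y₀)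
    (hy : y₀ ∉ MulAction.orbit G x₀) (x : T.V) :
    T.collapseMap x₀ y₀ x ∉ MulAction.orbit G x₀ := by
  by_cases h : x ∈ MulAction.orbit G x₀
  · obtain ⟨k, rfl⟩ := h
    dsimp only
    rw [collapseMap_smul_self hle]
    rwa [smul_mem_orbit_iff]
  · rwa [collapseMap_of_notMem h]

lemma vertexGroup_le_collapseMap (hle : T.vertexGroup x₀ ≤ T.vertexGroup y₀) (x : T.V) :
    T.vertexGroup x ≤ T.vertexGroup (T.collapseMap x₀ y₀ x) := by
  intro g hg
  rw [MulAction.mem_stabilizer_iff] at hg ⊢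
  rw [← collapseMap_smul hle, hg]

lemma collapseMap_fibre (hle : T.vertexGroup x₀ ≤ T.vertexGroup y₀) (hadj : T.tree.Adj x₀ y₀)
    (hy : y₀ ∉ MulAction.orbit G x₀) (P : T.V → Prop)
    (hP : ∀ x y, T.tree.Adj x y → T.collapseMap x₀ y₀ x = T.collapseMap x₀ y₀ y → P x → P y)
    {x y : T.V} (hxy : T.collapseMap x₀ y₀ x = T.collapseMap x₀ y₀ y) (hx : P x) : P y := by
  have key : ∀ x, T.collapseMap x₀ y₀ x = x ∨ (T.tree.Adj x (T.collapseMap x₀ y₀ x) ∧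
      T.collapseMap x₀ y₀ x = T.collapseMap x₀ y₀ (T.collapseMap x₀ y₀ x)) := by
    intro x
    by_cases h : x ∈ MulAction.orbit G x₀
    · refine Or.inr ⟨?_, (collapseMap_of_notMem (collapseMap_notMem hle hy x)).symm⟩
      obtain ⟨k, rfl⟩ := h
      dsimp only
      rw [collapseMap_smul_self hle]
      exact T.smul_adj k _ _ hadj
    · exact Or.inl (collapseMap_of_notMem h)
  have h1 : P (T.collapseMap x₀ y₀ x) := by
    rcases key x with h | ⟨h, h'⟩
    · rwa [h]
    · exact hP _ _ h h' hx
  rw [hxy] at h1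
  rcases key y with h | ⟨h, h'⟩
  · rwa [h] at h1
  · exact hP _ _ h.symm h'.symm h1

/-- The splitting obtained by collapsing the orbit of an edge from `x₀` to `y₀` whose group is
the vertex group of `x₀`. Its vertices are those outside the orbit of `x₀`, with unchanged vertex
groups. -/
noncomputable def collapse (hle : T.vertexGroup x₀ ≤ T.vertexGroup y₀)
    (hadj : T.tree.Adj x₀ y₀) (hy : y₀ ∉ MulAction.orbit G x₀) : Splitting G :=
  let ρ : T.V → {x : T.V // x ∉ MulAction.orbit G x₀} :=
    fun x => ⟨T.collapseMap x₀ y₀ x, collapseMap_notMem hle hy x⟩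
  have hfib : ∀ P : T.V → Prop, (∀ x y, T.tree.Adj x y → ρ x = ρ y → P x → P y) →
      ∀ x y, ρ x = ρ y → P x → P y := fun P hP x y hxy =>
    collapseMap_fibre hle hadj hy P (fun a b hab h => hP a b hab (Subtype.ext h))
      (congrArg Subtype.val hxy)
  { V := {x : T.V // x ∉ MulAction.orbit G x₀}
    tree := T.tree.contract ρ
    isTree := T.isTree.contract hfib fun x => ⟨x.1, Subtype.ext (collapseMap_of_notMem x.2)⟩
    action :=
      { smul := fun g x => ⟨g • x.1, by rw [smul_mem_orbit_iff]; exact x.2⟩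
        one_smul := fun x => Subtype.ext (one_smul G x.1)
        mul_smul := fun g h x => Subtype.ext (mul_smul g h x.1) }
    smul_adj := by
      rintro g _ _ ⟨hne, x, y, hxy, rfl, rfl⟩
      refine ⟨fun h => hne (Subtype.ext (smul_left_cancel g (congrArg Subtype.val h))),
        g • x, g • y, T.smul_adj g _ _ hxy, ?_, ?_⟩ <;>
      exact Subtype.ext (collapseMap_smul hle g _)
    no_inversion := by
      rintro g _ _ ⟨hne, x, y, hxy, rfl, rfl⟩ ⟨h1, h2⟩
      have e1 : ρ y = ρ (g • x) := by
        rw [← h1]; exact Subtype.ext (collapseMap_smul hle g _).symm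
      have e2 : ρ x = ρ (g • y) := by
        rw [← h2]; exact Subtype.ext (collapseMap_smul hle g _).symm
      have := T.isTree.isAcyclic.contract_edge_unique hfib hxy
        (T.smul_adj g _ _ hxy).symm hne e2 e1
      exact T.no_inversion g x y hxy ⟨this.2, this.1⟩ }

/-- Collapsing one orbit of edges of a splitting keeps cyclicity and acylindricity. -/
lemma exists_collapse (hcyc : T.IsCyclicSplitting) (hac : T.IsAcylindrical)
    (hle : T.vertexGroup x₀ ≤ T.vertexGroup y₀)
    (hadj : T.tree.Adj x₀ y₀) (hy : y₀ ∉ MulAction.orbit G x₀) :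
    ∃ (T' : Splitting G) (f : T'.V →[G] T.V), Function.Injective f ∧
      (∀ x, x ∈ Set.range f ↔ x ∉ MulAction.orbit G x₀) ∧
      T'.IsCyclicSplitting ∧ T'.IsAcylindrical := by
  let T' := T.collapse hle hadj hy
  let f : T'.V →[G] T.V := ⟨fun x => x.1, fun _ _ => rfl⟩
  have hf : Function.Injective f := Subtype.val_injective
  refine ⟨T', f, hf, fun x => ?_, ?_, ?_⟩
  · exact ⟨by rintro ⟨x, rfl⟩; exact x.2, fun h => ⟨⟨x, h⟩, rfl⟩⟩
  · intro a b hab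
    have hne : f a ≠ f b := fun h => hab.ne (hf h)
    have hgrp : T'.edgeGroup a b = T.vertexGroup (f a) ⊓ T.vertexGroup (f b) := by
      rw [vertexGroup_apply_of_injective f hf, vertexGroup_apply_of_injective f hf]
    rw [hgrp]
    refine ⟨hcyc.isCyclic_inf hne, ?_⟩
    obtain ⟨-, x, y, hxy, rfl, rfl⟩ := hab
    have := (hcyc x y hxy).2
    exact Infinite.of_injective _ (Subgroup.inclusion_injective
      (inf_le_inf (vertexGroup_le_collapseMap hle x) (vertexGroup_le_collapseMap hle y)))
  · obtain ⟨k, hk⟩ := hac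
    refine ⟨k, fun a b hab => ?_⟩
    rw [← vertexGroup_apply_of_injective f hf, ← vertexGroup_apply_of_injective f hf]
    refine hk _ _ (hab.trans_le ?_)
    have h1 := SimpleGraph.dist_contract_le (ρ := fun x => (⟨T.collapseMap x₀ y₀ x,
      collapseMap_notMem hle hy x⟩ : {x : T.V // x ∉ MulAction.orbit G x₀}))
      T.isTree.connected (f a) (f b)
    have h2 : ∀ c : T'.V, (⟨T.collapseMap x₀ y₀ (f c), collapseMap_notMem hle hy (f c)⟩ :
        {x : T.V // x ∉ MulAction.orbit G x₀}) = c := fun c =>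
      Subtype.ext (collapseMap_of_notMem c.2)
    rw [h2 a, h2 b] at h1
    exact h1

end collapse

/-- The map induced by an equivariant map of vertices on the vertices of the quotient graphs. -/
def quotientVertexMap {T' : Splitting G} (f : T'.V →[G] T.V) :
    T'.QuotientVertex → T.QuotientVertex :=
  Quotient.map f (by
    rintro _ b ⟨g, rfl⟩
    exact ⟨g, (map_smul f g b).symm⟩)

lemma quotientVertexMap_injective {T' : Splitting G} (f : T'.V →[G] T.V)
    (hf : Function.Injective f) : Function.Injective (quotientVertexMap f) := by
  intro a b
  induction a using Quotient.inductionOn with | _ a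
  induction b using Quotient.inductionOn with | _ b
  intro h
  obtain ⟨g, hg⟩ := Quotient.exact h
  exact Quotient.sound ⟨g, hf (by rw [map_smul]; exact hg)⟩

/-- A cocompact acylindrical cyclic splitting can be collapsed to a reduced one, without losing
any of the noncyclic vertex groups. -/
theorem exists_reduced (T : Splitting G) [hfin : Finite T.QuotientVertex]
    (hcyc : T.IsCyclicSplitting) (hac : T.IsAcylindrical) :
    ∃ (T' : Splitting G) (f : T'.V →[G] T.V), Function.Injective f ∧
      (∀ x, ¬ IsCyclic (T.vertexGroup x) → x ∈ Set.range f) ∧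
      T'.IsReduced ∧ T'.IsCyclicSplitting ∧ T'.IsAcylindrical := by
  obtain ⟨n, hn⟩ : ∃ n, Nat.card T.QuotientVertex = n := ⟨_, rfl⟩
  induction n using Nat.strong_induction_on generalizing T with
  | _ n ih =>
  by_cases hred : T.IsReduced
  · exact ⟨T, MulActionHom.id G, fun _ _ h => h, fun x _ => ⟨x, rfl⟩, hred, hcyc, hac⟩
  obtain ⟨x₀, y₀, hadj, hy, heq⟩ : ∃ x₀ y₀ : T.V, T.tree.Adj x₀ y₀ ∧
      y₀ ∉ MulAction.orbit G x₀ ∧ T.edgeGroup x₀ y₀ = T.vertexGroup x₀ := by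
    rw [IsReduced] at hred
    push Not at hred
    obtain ⟨v, w, hvw, hw, h⟩ := hred
    by_cases hv : T.edgeGroup v w = T.vertexGroup v
    · exact ⟨v, w, hvw, hw, hv⟩
    · refine ⟨w, v, hvw.symm, fun h' => hw (MulAction.mem_orbit_symm.1 h'), ?_⟩
      rw [edgeGroup, inf_comm]
      exact h hv
  obtain ⟨T₁, f₁, hf₁, hr₁, hc₁, ha₁⟩ := exists_collapse hcyc hac (inf_eq_left.1 heq) hadj hy
  have hinj := quotientVertexMap_injective f₁ hf₁
  have hfin₁ : Finite T₁.QuotientVertex := Finite.of_injective _ hinj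
  have hlt : Nat.card T₁.QuotientVertex < n := by
    rw [← hn]
    refine lt_of_le_of_ne (Nat.card_le_card_of_injective _ hinj) fun h => ?_
    obtain ⟨q, hq⟩ := ((Nat.bijective_iff_injective_and_card _).2 ⟨hinj, h⟩).2
      (Quotient.mk _ x₀)
    induction q using Quotient.inductionOn with | _ q
    have hq' : f₁ q ∈ MulAction.orbit G x₀ := Quotient.exact hq
    exact (hr₁ _).1 ⟨q, rfl⟩ hq'
  obtain ⟨T', f, hf, hr, hrest⟩ := ih _ hlt T₁ hc₁ ha₁ rfl
  refine ⟨T', f₁.comp f, hf₁.comp hf, fun x hx => ?_, hrest⟩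
  have hx₁ : x ∈ Set.range f₁ := by
    rw [hr₁]
    rintro ⟨g, rfl⟩
    exact hx (T.isCyclic_vertexGroup_smul (heq ▸ (hcyc x₀ y₀ hadj).1))
  obtain ⟨z, rfl⟩ := hx₁
  rw [vertexGroup_apply_of_injective f₁ hf₁] at hx
  obtain ⟨w, rfl⟩ := hr z hx
  exact ⟨w, rfl⟩

end Splitting

namespace Splitting

/-! ### Restriction of a splitting -/

section comap

variable {G H : Type u} [Group G] [Group H] (T : Splitting G) (j : H →* G)

/-- The splitting of `H` obtained by letting `H` act through a homomorphism. -/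
def comap : Splitting H where
  V := T.V
  tree := T.tree
  isTree := T.isTree
  action := MulAction.compHom T.V j
  smul_adj h := T.smul_adj (j h)
  no_inversion h := T.no_inversion (j h)

lemma comap_vertexGroup (v : T.V) : (T.comap j).vertexGroup v = (T.vertexGroup v).comap j := rfl

lemma comap_edgeGroup (v w : T.V) : (T.comap j).edgeGroup v w = (T.edgeGroup v w).comap j := rfl

variable {j}

/-- The preimage of a subgroup with an element of infinite order under a map with image of finite
index is infinite. -/
lemma infinite_comap_of_not_isOfFinOrder (hidx : j.range.index ≠ 0) {K : Subgroup G} {c : G}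
    (hcK : c ∈ K) (hc : ¬ IsOfFinOrder c) : Infinite (K.comap j) := by
  obtain ⟨n, hn, -, h, hh⟩ := Subgroup.exists_pow_mem_of_index_ne_zero hidx c
  have hinj : Function.Injective fun m : ℕ => h ^ m := by
    rw [injective_pow_iff_not_isOfFinOrder]
    intro hf
    have := j.isOfFinOrder hf
    rw [hh, isOfFinOrder_pow] at this
    rcases this with h1 | h1
    · exact hc h1
    · omega
  refine Infinite.of_injective (fun m : ℕ => (⟨h ^ m, ?_⟩ : K.comap j)) fun a b hab =>
    hinj (congrArg Subtype.val hab)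
  rw [Subgroup.mem_comap, map_pow, hh]
  exact pow_mem (pow_mem hcK n) m

lemma exists_generator_of_infinite_isCyclic {K : Subgroup G} (hK : IsCyclic K)
    (hK' : Infinite K) : ∃ c ∈ K, ¬ IsOfFinOrder c ∧ ∀ x ∈ K, ∃ m : ℤ, c ^ m = x := by
  obtain ⟨⟨c, hc⟩, hgen⟩ := hK.exists_generator
  refine ⟨c, hc, ?_, ?_⟩
  · intro hf
    have h1 : IsOfFinOrder (⟨c, hc⟩ : K) := by
      rwa [← Submonoid.isOfFinOrder_coe]
    have h2 : (Subgroup.zpowers (⟨c, hc⟩ : K) : Set K).Finite := finite_zpowers.2 h1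
    have h3 : (Subgroup.zpowers (⟨c, hc⟩ : K) : Set K) = Set.univ :=
      Set.eq_univ_of_forall hgen
    rw [h3] at h2
    exact Set.infinite_univ h2
  · intro x hx
    obtain ⟨m, hm⟩ := hgen ⟨x, hx⟩
    exact ⟨m, congrArg Subtype.val hm⟩

lemma isCyclic_comap (hj : Function.Injective j) {K : Subgroup G} (hK : IsCyclic K) :
    IsCyclic (K.comap j) :=
  isCyclic_of_injective (j.subgroupComap K) fun _ _ h =>
    Subtype.ext (hj (congrArg Subtype.val h))

variable {T}

lemma IsCyclicSplitting.comap (hT : T.IsCyclicSplitting) (hj : Function.Injective j)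
    (hidx : j.range.index ≠ 0) : (T.comap j).IsCyclicSplitting := by
  intro v w hvw
  obtain ⟨h1, h2⟩ := hT v w hvw
  obtain ⟨c, hc, hc', -⟩ := exists_generator_of_infinite_isCyclic h1 h2
  exact ⟨isCyclic_comap hj h1, infinite_comap_of_not_isOfFinOrder hidx hc hc'⟩

lemma IsAcylindrical.comap (hT : T.IsAcylindrical) (hj : Function.Injective j) :
    (T.comap j).IsAcylindrical := by
  obtain ⟨k, hk⟩ := hT
  refine ⟨k, fun v w hvw => ?_⟩
  change (T.vertexGroup v ⊓ T.vertexGroup w).comap j = ⊥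
  rw [hk v w hvw]
  exact (MonoidHom.ker_eq_bot_iff j).2 hj

lemma finite_quotientVertex_comap [Finite T.QuotientVertex] (hidx : j.range.index ≠ 0) :
    Finite (T.comap j).QuotientVertex := by
  have : Finite (G ⧸ j.range) := (Nat.card_ne_zero.1 hidx).2
  refine Finite.of_surjective (fun p : (G ⧸ j.range) × T.QuotientVertex =>
    (Quotient.mk _ ((p.1.out)⁻¹ • p.2.out : T.V) : (T.comap j).QuotientVertex)) ?_
  intro q
  obtain ⟨x, rfl⟩ : ∃ x : T.V, (Quotient.mk _ x : (T.comap j).QuotientVertex) = q :=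
    Quotient.exists_rep q
  obtain ⟨g, hg⟩ : x ∈ MulAction.orbit G (Quotient.mk _ x : T.QuotientVertex).out :=
    MulAction.orbitRel_apply.1 (Quotient.exact (Quotient.out_eq _).symm)
  obtain ⟨⟨-, h, rfl⟩, hh⟩ := QuotientGroup.mk_out_eq_mul j.range g⁻¹
  refine ⟨(QuotientGroup.mk g⁻¹, Quotient.mk _ x), Quotient.sound ⟨h⁻¹, ?_⟩⟩
  dsimp only at hg ⊢
  rw [hh]
  change j h⁻¹ • x = _
  conv_lhs => rw [← hg]
  rw [← mul_smul]
  simp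

end comap

variable {G : Type u} [Group G]

lemma finite_quotientEdge {T : Splitting G} {A : Set T.tree.Dart} (hA : A.Finite)
    (h : ∀ d : T.tree.Dart, ∃ g : G, g • d ∈ A) : Finite T.QuotientEdge := by
  have := hA.to_subtype
  refine Finite.of_surjective (fun d : A => (Quotient.mk _ d.1 : T.QuotientEdge)) ?_
  intro q
  induction q using Quotient.inductionOn with | _ d
  obtain ⟨g, hg⟩ := h d
  exact ⟨⟨g • d, hg⟩, Quotient.sound ⟨g, rfl⟩⟩

lemma finite_quotientVertex {T : Splitting G} [Finite T.QuotientEdge] :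
    Finite T.QuotientVertex := by
  by_cases hs : Subsingleton T.V
  · exact Quotient.finite _
  · rw [not_subsingleton_iff_nontrivial] at hs
    refine Finite.of_surjective T.origin fun q => ?_
    induction q using Quotient.inductionOn with | _ x
    obtain ⟨y, hy⟩ := exists_ne x
    obtain ⟨x', hx, -⟩ := T.exists_adj_of_ne hy.symm
    exact ⟨Quotient.mk _ ⟨(x, x'), hx⟩, rfl⟩

/-! ### Cocompact subtrees -/

section hull

variable (T : Splitting G) (S : Set G) (v : T.V)

/-- The union of the translates of paths from `v` to `s • v`, for `s` in a set `S`. -/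
noncomputable def hullGraph : SimpleGraph T.V where
  Adj x y := ∃ g : G, ∃ s ∈ S,
    s(g • x, g • y) ∈ (T.isTree.connected.preconnected v (s • v)).some.edges
  symm := ⟨by
    rintro x y ⟨g, s, hs, h⟩
    exact ⟨g, s, hs, by rwa [Sym2.eq_swap]⟩⟩
  loopless := ⟨by
    rintro x ⟨g, s, hs, h⟩
    exact (SimpleGraph.Walk.adj_of_mem_edges _ h).ne rfl⟩

variable {T S v}

lemma hullGraph_le : T.hullGraph S v ≤ T.tree := by
  rintro x y ⟨g, s, hs, h⟩
  simpa using T.smul_adj g⁻¹ _ _ (SimpleGraph.Walk.adj_of_mem_edges _ h)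

lemma hullGraph_adj_smul (g : G) {x y : T.V} (h : (T.hullGraph S v).Adj x y) :
    (T.hullGraph S v).Adj (g • x) (g • y) := by
  obtain ⟨k, s, hs, h⟩ := h
  refine ⟨k * g⁻¹, s, hs, ?_⟩
  rwa [mul_smul, inv_smul_smul, mul_smul, inv_smul_smul]

lemma hullGraph_reachable_smul (g : G) {x y : T.V} (h : (T.hullGraph S v).Reachable x y) :
    (T.hullGraph S v).Reachable (g • x) (g • y) :=
  h.map (⟨(g • ·), fun h => hullGraph_adj_smul g h⟩ : T.hullGraph S v →g T.hullGraph S v)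

lemma hullGraph_reachable (hS : Subgroup.closure S = ⊤) (g : G) :
    (T.hullGraph S v).Reachable v (g • v) := by
  have hg : g ∈ Subgroup.closure S := hS ▸ Subgroup.mem_top g
  induction hg using Subgroup.closure_induction with
  | mem s hs =>
    let w := (T.isTree.connected.preconnected v (s • v)).some
    refine ⟨w.transfer _ fun e he => ?_⟩
    induction e using Sym2.ind with | _ x y
    exact ⟨1, s, hs, by simpa using he⟩
  | one => rw [one_smul]
  | mul a b _ _ iha ihb =>
    rw [mul_smul]
    exact iha.trans (hullGraph_reachable_smul a ihb)
  | inv a _ ih => simpa using (hullGraph_reachable_smul a⁻¹ ih).symm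

/-- The splitting given by the subtree spanned by an orbit. -/
noncomputable def hull (T : Splitting G) (S : Set G) (hS : Subgroup.closure S = ⊤) (v : T.V) :
    Splitting G :=
  have hsmul : ∀ (g : G) (x : T.V), x ∈ ((T.hullGraph S v).connectedComponentMk v).supp →
      g • x ∈ ((T.hullGraph S v).connectedComponentMk v).supp := by
    intro g x hx
    rw [SimpleGraph.ConnectedComponent.mem_supp_iff, SimpleGraph.ConnectedComponent.eq] at hx ⊢
    exact (hullGraph_reachable_smul g hx).trans (hullGraph_reachable hS g).symm
  { V := ((T.hullGraph S v).connectedComponentMk v).supp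
    tree := ((T.hullGraph S v).connectedComponentMk v).toSimpleGraph
    isTree := (T.isTree.isAcyclic.anti hullGraph_le).isTree_connectedComponent _
    action :=
      { smul := fun g x => ⟨g • x.1, hsmul g _ x.2⟩
        one_smul := fun x => Subtype.ext (one_smul G x.1)
        mul_smul := fun g h x => Subtype.ext (mul_smul g h x.1) }
    smul_adj := fun g x y h => hullGraph_adj_smul g h
    no_inversion := fun g x y h h' => T.no_inversion g x.1 y.1 (hullGraph_le h)
      ⟨congrArg Subtype.val h'.1, congrArg Subtype.val h'.2⟩ }

/-- A finitely generated group acts cocompactly on a subtree containing a given vertex. -/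
theorem exists_cocompact (T : Splitting G) [hfg : Group.FG G] (v : T.V) :
    ∃ (T₀ : Splitting G) (f : T₀.V →[G] T.V), Function.Injective f ∧
      (∀ x y, T₀.tree.Adj x y → T.tree.Adj (f x) (f y)) ∧ v ∈ Set.range f ∧
      Finite T₀.QuotientEdge := by
  obtain ⟨S, hS, hSfin⟩ := Group.fg_iff.1 hfg
  let f : (T.hull S hS v).V →[G] T.V := ⟨fun x => x.1, fun _ _ => rfl⟩
  have hf : Function.Injective f := Subtype.val_injective
  refine ⟨T.hull S hS v, f, hf, fun x y h => hullGraph_le h, ⟨⟨v, rfl⟩, rfl⟩, ?_⟩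
  let W : Set T.V := ⋃ s ∈ S,
    {x | x ∈ (T.isTree.connected.preconnected v (s • v)).some.support}
  have hW : W.Finite := hSfin.biUnion fun s _ => List.finite_toSet _
  refine finite_quotientEdge (A := {d | (f d.fst, f d.snd) ∈ W ×ˢ W}) ?_ ?_
  · refine (hW.prod hW).preimage (f := fun d : (T.hull S hS v).tree.Dart => (f d.fst, f d.snd)) ?_
    intro d _ d' _ h
    simp only [Prod.mk.injEq] at h
    exact SimpleGraph.Dart.ext _ _ (Prod.ext (hf h.1) (hf h.2))
  · intro d
    obtain ⟨g, s, hs, h⟩ := d.adj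
    exact ⟨g, Set.mem_biUnion hs (SimpleGraph.Walk.fst_mem_support_of_mem_edges _ h),
      Set.mem_biUnion hs (SimpleGraph.Walk.snd_mem_support_of_mem_edges _ h)⟩

end hull

/-! ### Acylindricity -/

/-- Cocompact cyclic splittings of hyperbolic groups are acylindrical: the edges
in a given orbit which are fixed by a nontrivial element differ by elements that commensurate
their groups, so that their number is bounded. -/
theorem isAcylindrical_of_isHyperbolicGroup (hG : IsHyperbolicGroup G) {T : Splitting G}
    [hfin : Finite T.QuotientEdge] (hT : T.IsCyclicSplitting) : T.IsAcylindrical := by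
  classical
  have := Fintype.ofFinite T.QuotientEdge
  choose c hc hc' hgen using fun q : T.QuotientEdge =>
    exists_generator_of_infinite_isCyclic (hT _ _ q.out.adj).1 (hT _ _ q.out.adj).2
  choose F hF hFc using fun q => hG.exists_finite_commensurator (hc' q)
  have hτ : ∀ d : T.tree.Dart, ∃ t : G, t • (Quotient.mk _ d : T.QuotientEdge).out = d :=
    fun d => MulAction.orbitRel_apply.1 (Quotient.exact (Quotient.out_eq _).symm)
  choose τ hτ using hτ
  refine ⟨Fintype.card (Σ q : T.QuotientEdge, (hF q).toFinset), fun a b hab => ?_⟩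
  rw [Subgroup.eq_bot_iff_forall]
  rintro g ⟨hga, hgb⟩
  by_contra hg1
  obtain ⟨w, hw, hl⟩ := T.isTree.connected.exists_path_of_dist a b
  have hfix : ∀ d ∈ w.darts, g • d = d := by
    intro d hd
    have hsupp : ∀ x ∈ w.support, g • x = x := by
      intro x hx
      obtain ⟨n, rfl, -⟩ := SimpleGraph.Walk.mem_support_iff_exists_getVert.1 hx
      exact T.smul_getVert hw hga hgb n
    exact SimpleGraph.Dart.ext _ _ (Prod.ext (hsupp _ (w.dart_fst_mem_support_of_mem_darts hd))
      (hsupp _ (w.dart_snd_mem_support_of_mem_darts hd)))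
  have hpow : ∀ d ∈ w.darts, ∃ m : ℤ, m ≠ 0 ∧
      g = τ d * c (Quotient.mk _ d) ^ m * (τ d)⁻¹ := by
    intro d hd
    have h1 : ((τ d)⁻¹ * g * τ d) • (Quotient.mk _ d : T.QuotientEdge).out =
        (Quotient.mk _ d : T.QuotientEdge).out := by
      rw [mul_smul, mul_smul, hτ, hfix d hd, inv_smul_eq_iff, hτ]
    obtain ⟨m, hm⟩ := hgen (Quotient.mk _ d) ((τ d)⁻¹ * g * τ d)
      ⟨congrArg (fun d : T.tree.Dart => d.fst) h1, congrArg (fun d : T.tree.Dart => d.snd) h1⟩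
    refine ⟨m, ?_, ?_⟩
    · rintro rfl
      apply hg1
      rw [zpow_zero, eq_comm, mul_assoc, inv_mul_eq_one, eq_comm] at hm
      simpa using hm
    · rw [hm]; group
  choose! m hm0 hm using hpow
  -- a base edge of the path in each orbit that the path meets
  have hbase : ∀ q : T.QuotientEdge, ∃ t : G, ∀ d ∈ w.darts, Quotient.mk _ d = q →
      ∃ j : ℤ, t⁻¹ * τ d * c q ^ j ∈ F q := by
    intro q
    by_cases hq : ∃ d ∈ w.darts, Quotient.mk _ d = q
    · obtain ⟨d₀, hd₀, rfl⟩ := hq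
      refine ⟨τ d₀, fun d hd hdq => hFc _ _ (m d) (m d₀) (hm0 d₀ hd₀) ?_⟩
      have e1 := hm d hd
      have e2 := hm d₀ hd₀
      rw [hdq] at e1
      rw [e1] at e2
      rw [show (τ d₀)⁻¹ * τ d * c (Quotient.mk _ d₀) ^ m d = (τ d₀)⁻¹ *
        (τ d * c (Quotient.mk _ d₀) ^ m d * (τ d)⁻¹) * τ d by group, e2]
      group
    · exact ⟨1, fun d hd hdq => absurd ⟨d, hd, hdq⟩ hq⟩
  choose t ht using hbase
  have ht' : ∀ d : T.tree.Dart, ∃ j : ℤ, d ∈ w.darts →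
      (t (Quotient.mk _ d))⁻¹ * τ d * c (Quotient.mk _ d) ^ j ∈ F (Quotient.mk _ d) := by
    intro d
    by_cases hd : d ∈ w.darts
    · obtain ⟨j, hj⟩ := ht (Quotient.mk _ d) d hd rfl
      exact ⟨j, fun _ => hj⟩
    · exact ⟨0, fun h => absurd h hd⟩
  choose j hj using ht'
  have hcard : w.darts.toFinset.card ≤
      Fintype.card (Σ q : T.QuotientEdge, (hF q).toFinset) := by
    rw [← Fintype.card_coe]
    refine Fintype.card_le_of_injective (fun d => ⟨Quotient.mk _ d.1, _,
      (hF _).mem_toFinset.2 (hj d.1 (List.mem_toFinset.1 d.2))⟩) ?_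
    rintro ⟨d, hd⟩ ⟨d', hd'⟩ h
    have h1 := congrArg Sigma.fst h
    dsimp only at h1
    have h3 : (t (Quotient.mk _ d))⁻¹ * τ d * c (Quotient.mk _ d) ^ j d =
        (t (Quotient.mk _ d'))⁻¹ * τ d' * c (Quotient.mk _ d') ^ j d' :=
      congrArg (fun p : (Σ q : T.QuotientEdge, (hF q).toFinset) => (p.2 : G)) h
    rw [← h1, mul_assoc, mul_assoc, mul_right_inj] at h3
    have hcfix : ∀ i : ℤ, c (Quotient.mk _ d) ^ i • (Quotient.mk _ d : T.QuotientEdge).out =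
        (Quotient.mk _ d : T.QuotientEdge).out := by
      intro i
      have := zpow_mem (hc (Quotient.mk _ d)) i
      exact SimpleGraph.Dart.ext _ _ (Prod.ext this.1 this.2)
    have h4 : d = d' := by
      rw [← hτ d, ← hcfix (j d), ← mul_smul, h3, mul_smul, hcfix, h1, hτ]
    exact Subtype.ext h4
  rw [List.toFinset_card_of_nodup (SimpleGraph.Walk.darts_nodup_of_support_nodup
    hw.support_nodup), SimpleGraph.Walk.length_darts] at hcard
  omega

end Splitting

namespace Splitting

/-! ### Finite generation of vertex groups -/

section blowUp

variable {G : Type u} [Group G] (T : Splitting G) (v : T.V) (A : Subgroup G)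
  (κ : T.tree.Dart → G)

open Classical in
/-- The initial vertex of an edge in the graph `blowUp`: at the vertices in the orbit of `v`, the
edge `d` is attached to the coset `κ d * A`. -/
noncomputable def blowUpOrigin (d : T.tree.Dart) : (G ⧸ A) ⊕ T.V :=
  if d.fst ∈ MulAction.orbit G v then Sum.inl (κ d) else Sum.inr d.fst

/-- The graph with the same edges as the tree `T`, in which the orbit of `v` is replaced by the
cosets of a subgroup `A` of the group of `v`. -/
def blowUp : SimpleGraph ((G ⧸ A) ⊕ T.V) where
  Adj p q := p ≠ q ∧ ∃ d : T.tree.Dart, T.blowUpOrigin v A κ d = p ∧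
    T.blowUpOrigin v A κ d.symm = q
  symm := ⟨fun _ _ ⟨h, d, hd, hd'⟩ => ⟨h.symm, d.symm, hd', by rwa [d.symm_symm]⟩⟩
  loopless := ⟨fun _ h => h.1 rfl⟩

variable {T v A κ}

/-- The projection of `blowUp` to the tree. -/
def blowUpProj (hA : A ≤ T.vertexGroup v) : (G ⧸ A) ⊕ T.V → T.V :=
  Sum.elim (Quotient.lift (fun g : G => g • v) (by
    intro a b hab
    have := hA (QuotientGroup.leftRel_apply.1 hab)
    rw [MulAction.mem_stabilizer_iff, mul_smul, inv_smul_eq_iff] at this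
    exact this.symm)) id

lemma blowUpProj_origin (hA : A ≤ T.vertexGroup v)
    (hκ : ∀ d : T.tree.Dart, d.fst ∈ MulAction.orbit G v → κ d • v = d.fst) (d : T.tree.Dart) :
    blowUpProj hA (T.blowUpOrigin v A κ d) = d.fst := by
  rw [blowUpOrigin]
  split_ifs with h
  · exact hκ d h
  · rfl

lemma blowUpOrigin_smul (hκA : ∀ (g : G) (d : T.tree.Dart), d.fst ∈ MulAction.orbit G v →
      (κ (g • d))⁻¹ * (g * κ d) ∈ A) (g : G) (d : T.tree.Dart) :
    T.blowUpOrigin v A κ (g • d) = Sum.map (g • ·) (g • ·) (T.blowUpOrigin v A κ d) := by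
  have h1 : (g • d).fst = g • d.fst := rfl
  rw [blowUpOrigin, blowUpOrigin, h1]
  by_cases h : d.fst ∈ MulAction.orbit G v
  · rw [if_pos h, if_pos (smul_mem_orbit_iff.2 h), Sum.map_inl]
    exact congrArg Sum.inl (QuotientGroup.eq.2 (hκA g d h))
  · rw [if_neg h, if_neg (fun h' => h (smul_mem_orbit_iff.1 h')), Sum.map_inr]

lemma blowUp_reachable_smul (hκA : ∀ (g : G) (d : T.tree.Dart), d.fst ∈ MulAction.orbit G v →
      (κ (g • d))⁻¹ * (g * κ d) ∈ A) (g : G) {p q : (G ⧸ A) ⊕ T.V}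
    (h : (T.blowUp v A κ).Reachable p q) :
    (T.blowUp v A κ).Reachable (Sum.map (g • ·) (g • ·) p) (Sum.map (g • ·) (g • ·) q) := by
  refine h.map (⟨Sum.map (g • ·) (g • ·), ?_⟩ : T.blowUp v A κ →g T.blowUp v A κ)
  rintro _ _ ⟨hne, d, rfl, rfl⟩
  refine ⟨fun h => hne ?_, g • d, blowUpOrigin_smul hκA g d, blowUpOrigin_smul hκA g d.symm⟩
  exact Function.Injective.sumMap (MulAction.injective g) (MulAction.injective g) h

/-- If the blow-up is connected along the orbit of a coset, then nothing was blown up, as its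
projection to the tree is locally injective. -/
lemma le_of_blowUp_reachable (hA : A ≤ T.vertexGroup v)
    (hκ : ∀ d : T.tree.Dart, d.fst ∈ MulAction.orbit G v → κ d • v = d.fst)
    (hreach : ∀ g : G, (T.blowUp v A κ).Reachable (Sum.inl (1 : G)) (Sum.inl g)) :
    T.vertexGroup v ≤ A := by
  intro g hg
  have hproj := blowUpProj_origin hA hκ
  let π : T.blowUp v A κ →g T.tree := ⟨blowUpProj hA, by
    rintro _ _ ⟨-, d, rfl, rfl⟩
    rw [hproj, hproj]
    exact d.adj⟩
  have h := SimpleGraph.eq_of_reachable_of_locally_injective T.isTree.isAcyclic π ?_ (hreach g) ?_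
  · rw [Sum.inl.injEq, QuotientGroup.eq] at h
    simpa using h
  · rintro p q q' ⟨-, d, rfl, rfl⟩ ⟨-, d', hd, rfl⟩ he
    have h1 : d'.fst = d.fst := by rw [← hproj d', hd, hproj]
    have h2 : d.snd = d'.snd := by
      have := (hproj d.symm).symm.trans (he.trans (hproj d'.symm))
      exact this
    have : d = d' := SimpleGraph.Dart.ext _ _ (Prod.ext h1.symm h2)
    rw [this]
  · exact (one_smul G v).trans (MulAction.mem_stabilizer_iff.1 hg).symm

end blowUp

/-- If a finitely generated group splits cocompactly over cyclic groups, then its vertex groups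
are finitely generated: the subgroup `A` of the group of `v` generated by the incident edge groups
and by finitely many elements read off from the paths from `v` to `s • v`, for generators `s`, has
a connected blow-up. -/
theorem fg_vertexGroup {G : Type u} [Group G] [hfg : Group.FG G] {T : Splitting G}
    [hfin : Finite T.QuotientEdge] (hT : T.IsCyclicSplitting) (v : T.V) :
    (T.vertexGroup v).FG := by
  classical
  obtain ⟨S, hS, hSfin⟩ := Group.fg_iff.1 hfg
  choose c hc _ hgen using fun q : T.QuotientEdge =>
    exists_generator_of_infinite_isCyclic (hT _ _ q.out.adj).1 (hT _ _ q.out.adj).2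
  have hτ : ∀ d : T.tree.Dart, ∃ t : G, t • (Quotient.mk _ d : T.QuotientEdge).out = d :=
    fun d => MulAction.orbitRel_apply.1 (Quotient.exact (Quotient.out_eq _).symm)
  choose τ hτ using hτ
  have hr : ∀ x : T.V, ∃ g : G, x ∈ MulAction.orbit G v → g • v = x := by
    intro x
    by_cases hx : x ∈ MulAction.orbit G v
    · exact ⟨hx.choose, fun _ => hx.choose_spec⟩
    · exact ⟨1, fun h => absurd h hx⟩
  choose r hr using hr
  let κ : T.tree.Dart → G := fun d => τ d * r (Quotient.mk _ d : T.QuotientEdge).out.fst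
  have hout : ∀ d : T.tree.Dart, d.fst ∈ MulAction.orbit G v →
      (Quotient.mk _ d : T.QuotientEdge).out.fst ∈ MulAction.orbit G v := by
    intro d hd
    rw [← hτ d] at hd
    exact smul_mem_orbit_iff.1 hd
  have hκ : ∀ d : T.tree.Dart, d.fst ∈ MulAction.orbit G v → κ d • v = d.fst := by
    intro d hd
    rw [mul_smul, hr _ (hout d hd)]
    exact congrArg (fun d : T.tree.Dart => d.fst) (hτ d)
  -- the elements comparing the coset of an edge with that of its initial vertex
  let δ : T.tree.Dart → G := fun d =>
    if d.fst ∈ MulAction.orbit G v then (r d.fst)⁻¹ * κ d else 1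
  let w : ∀ s : G, T.tree.Walk v (s • v) := fun s =>
    (T.isTree.connected.preconnected v (s • v)).some
  let E : Set G := (fun q : T.QuotientEdge =>
    if q.out.fst ∈ MulAction.orbit G v then (r q.out.fst)⁻¹ * c q * r q.out.fst else 1) '' Set.univ
  let D : Set G := ⋃ s ∈ S, δ '' {d | d ∈ (w s).darts ∨ d.symm ∈ (w s).darts}
  let R : Set G := insert (r v) ((fun s => s⁻¹ * r (s • v)) '' S)
  have hfinD : D.Finite := by
    refine hSfin.biUnion fun s _ => Set.Finite.image _ ?_
    refine (List.finite_toSet (w s).darts).union ?_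
    exact (List.finite_toSet (w s).darts).preimage
      SimpleGraph.Dart.symm_involutive.injective.injOn
  have hfinER : (E ∪ D ∪ R).Finite :=
    ((Set.finite_univ.image _).union hfinD).union ((hSfin.image _).insert _)
  set A := Subgroup.closure (E ∪ D ∪ R) with hAdef
  have hEA : E ⊆ A := fun x hx => Subgroup.subset_closure (Or.inl (Or.inl hx))
  have hDA : D ⊆ A := fun x hx => Subgroup.subset_closure (Or.inl (Or.inr hx))
  have hRA : R ⊆ A := fun x hx => Subgroup.subset_closure (Or.inr hx)
  have hAv : A ≤ T.vertexGroup v := by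
    rw [hAdef, Subgroup.closure_le]
    rintro x ((⟨q, -, rfl⟩ | hx) | rfl | ⟨s, -, rfl⟩)
    · dsimp only
      split_ifs with h
      · rw [SetLike.mem_coe, MulAction.mem_stabilizer_iff, mul_smul, mul_smul, hr _ h,
          inv_smul_eq_iff, hr _ h]
        exact (hc q).1
      · exact one_mem _
    · obtain ⟨s, -, d, -, rfl⟩ := Set.mem_iUnion₂.1 hx
      dsimp only [δ]
      split_ifs with h
      · rw [SetLike.mem_coe, MulAction.mem_stabilizer_iff, mul_smul, hκ d h, inv_smul_eq_iff,
          hr _ h]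
      · exact one_mem _
    · exact hr v (MulAction.mem_orbit_self v)
    · rw [SetLike.mem_coe, MulAction.mem_stabilizer_iff, mul_smul, hr _ ⟨s, rfl⟩, inv_smul_smul]
  have hκA : ∀ (g : G) (d : T.tree.Dart), d.fst ∈ MulAction.orbit G v →
      (κ (g • d))⁻¹ * (g * κ d) ∈ A := by
    intro g d hd
    have hq : (Quotient.mk _ (g • d) : T.QuotientEdge) = Quotient.mk _ d :=
      Quotient.sound ⟨g, rfl⟩
    have h1 : ((τ (g • d))⁻¹ * g * τ d) • (Quotient.mk _ d : T.QuotientEdge).out =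
        (Quotient.mk _ d : T.QuotientEdge).out := by
      rw [mul_smul, mul_smul, hτ, inv_smul_eq_iff, ← hq, hτ]
    obtain ⟨m, hm⟩ := hgen (Quotient.mk _ d) ((τ (g • d))⁻¹ * g * τ d)
      ⟨congrArg (fun d : T.tree.Dart => d.fst) h1, congrArg (fun d : T.tree.Dart => d.snd) h1⟩
    have h2 : (r (Quotient.mk _ d : T.QuotientEdge).out.fst)⁻¹ * c (Quotient.mk _ d) *
        r (Quotient.mk _ d : T.QuotientEdge).out.fst ∈ A := by
      have := hEA ⟨Quotient.mk _ d, trivial, rfl⟩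
      dsimp only at this
      rwa [if_pos (hout d hd)] at this
    have h3 := zpow_mem h2 m
    dsimp only [κ]
    rw [hq]
    convert h3 using 1
    have h4 := conj_zpow (i := m) (a := (r (Quotient.mk _ d : T.QuotientEdge).out.fst)⁻¹)
      (b := c (Quotient.mk _ d))
    rw [inv_inv] at h4
    rw [h4, hm]
    group
  -- lifts of paths to the blow-up
  let σ : T.V → (G ⧸ A) ⊕ T.V := fun x =>
    if x ∈ MulAction.orbit G v then Sum.inl (r x) else Sum.inr x
  have hσ : ∀ d, δ d ∈ A → T.blowUpOrigin v A κ d = σ d.fst := by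
    intro d hd
    dsimp only [σ, δ] at hd ⊢
    rw [blowUpOrigin]
    split_ifs at hd ⊢ with h
    · exact congrArg Sum.inl (QuotientGroup.eq.2 hd).symm
    · rfl
  have hwalk : ∀ {x y : T.V} (p : T.tree.Walk x y),
      (∀ d ∈ p.darts, δ d ∈ A ∧ δ d.symm ∈ A) → (T.blowUp v A κ).Reachable (σ x) (σ y) := by
    intro x y p
    induction p with
    | nil => exact fun _ => SimpleGraph.Reachable.refl _
    | @cons x y z hxy p ih =>
      intro h
      simp only [SimpleGraph.Walk.darts_cons, List.mem_cons, forall_eq_or_imp] at h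
      refine SimpleGraph.Reachable.trans ?_ (ih h.2)
      have h1 := hσ _ h.1.1
      have h2 := hσ _ h.1.2
      by_cases he : σ x = σ y
      · rw [he]
      · exact SimpleGraph.Adj.reachable ⟨he, _, h1, h2⟩
  have hreach : ∀ g : G, (T.blowUp v A κ).Reachable (Sum.inl (1 : G)) (Sum.inl g) := by
    intro g
    have hg : g ∈ Subgroup.closure S := hS ▸ Subgroup.mem_top g
    induction hg using Subgroup.closure_induction with
    | mem s hs =>
      have h1 := hwalk (w s) fun d hd =>
        ⟨hDA (Set.mem_biUnion hs ⟨d, Or.inl hd, rfl⟩),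
          hDA (Set.mem_biUnion hs ⟨d.symm, Or.inr (by rwa [d.symm_symm]), rfl⟩)⟩
      have h2 : σ v = Sum.inl ((1 : G) : G ⧸ A) := by
        dsimp only [σ]
        rw [if_pos (MulAction.mem_orbit_self v)]
        refine congrArg Sum.inl (QuotientGroup.eq.2 ?_).symm
        rw [inv_one, one_mul]
        exact hRA (Or.inl rfl)
      have h3 : σ (s • v) = Sum.inl (s : G ⧸ A) := by
        dsimp only [σ]
        rw [if_pos ⟨s, rfl⟩]
        exact congrArg Sum.inl (QuotientGroup.eq.2 (hRA (Or.inr ⟨s, hs, rfl⟩))).symm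
      rwa [h2, h3] at h1
    | one => exact SimpleGraph.Reachable.refl _
    | mul a b _ _ iha ihb =>
      refine iha.trans ?_
      have := blowUp_reachable_smul hκA a ihb
      simpa using this
    | inv a _ ih =>
      have := blowUp_reachable_smul hκA a⁻¹ ih
      simpa using this.symm
  rw [le_antisymm (le_of_blowUp_reachable hAv hκ hreach) hAv]
  exact ⟨hfinER.toFinset, by rw [Set.Finite.coe_toFinset]⟩

end Splitting

/-! ### The Bass-Serre tree of a free product with an infinite cyclic group -/

namespace FreeCut

variable {F : Type u} [Group F] (c : FreeCut F)

/-- The graph on the cosets of `B` in which `g * B` is joined to `g * t * B`. -/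
def cosetGraph : SimpleGraph (F ⧸ c.B) :=
  SimpleGraph.fromRel fun p q => ∃ g : F, p = (g : F ⧸ c.B) ∧ q = ((g * c.t : F) : F ⧸ c.B)

lemma mk_ne_mk_mul_t (g : F) : (g : F ⧸ c.B) ≠ ((g * c.t : F) : F ⧸ c.B) := by
  intro h
  rw [QuotientGroup.eq, inv_mul_cancel_left] at h
  exact c.t_notMem h

lemma cosetGraph_adj {p q : F ⧸ c.B} : c.cosetGraph.Adj p q ↔
    (∃ g : F, p = (g : F ⧸ c.B) ∧ q = ((g * c.t : F) : F ⧸ c.B)) ∨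
      ∃ g : F, q = (g : F ⧸ c.B) ∧ p = ((g * c.t : F) : F ⧸ c.B) := by
  rw [cosetGraph, SimpleGraph.fromRel_adj]
  refine and_iff_right_of_imp ?_
  rintro (⟨g, rfl, rfl⟩ | ⟨g, rfl, rfl⟩)
  · exact c.mk_ne_mk_mul_t g
  · exact (c.mk_ne_mk_mul_t g).symm

lemma cosetGraph_adj_mk (g : F) : c.cosetGraph.Adj (g : F ⧸ c.B) ((g * c.t : F) : F ⧸ c.B) :=
  c.cosetGraph_adj.2 (Or.inl ⟨g, rfl, rfl⟩)

/-- The set `side`, as a set of cosets of `B`. -/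
def cosetSide : F ⧸ c.B → Prop :=
  Quotient.lift c.side (by
    intro a b hab
    have := c.side_mul a _ (QuotientGroup.leftRel_apply.1 hab)
    rw [mul_inv_cancel_left] at this
    exact propext this.symm)

lemma cosetGraph_isTree : c.cosetGraph.IsTree := by
  refine ⟨?_, SimpleGraph.isAcyclic_of_forall_exists_cut ?_⟩
  · have h1 : ∀ g : F, c.cosetGraph.Reachable ((1 : F) : F ⧸ c.B) (g : F ⧸ c.B) := by
      intro g
      have hg : g ∈ Subgroup.closure ((c.B : Set F) ∪ {c.t}) := by rw [c.closure_eq]; trivial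
      induction hg using Subgroup.closure_induction_right with
      | one => exact SimpleGraph.Reachable.refl _
      | mul_right x _ y hy ih =>
        rcases hy with hy | rfl
        · rwa [QuotientGroup.mk_mul_of_mem x hy]
        · exact ih.trans (c.cosetGraph_adj_mk x).reachable
      | mul_inv_cancel x _ y hy ih =>
        rcases hy with hy | rfl
        · rwa [QuotientGroup.mk_mul_of_mem x (inv_mem hy)]
        · have := c.cosetGraph_adj_mk (x * c.t⁻¹)
          rw [inv_mul_cancel_right] at this
          exact ih.trans this.symm.reachable
    refine (SimpleGraph.connected_iff _).2 ⟨fun p q => ?_, ⟨((1 : F) : F ⧸ c.B)⟩⟩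
    obtain ⟨g, rfl⟩ := QuotientGroup.mk_surjective p
    obtain ⟨h, rfl⟩ := QuotientGroup.mk_surjective q
    exact (h1 g).symm.trans (h1 h)
  · -- the translates of `side` by `g` and its complement are separated by the edge at `g`
    have hside : ∀ g k : F, (c.cosetSide ((g⁻¹ * k : F) : F ⧸ c.B) ↔
        ¬ c.cosetSide ((g⁻¹ * (k * c.t) : F) : F ⧸ c.B)) → k = g := by
      intro g k h
      by_contra hne
      have h1 : c.side (g⁻¹ * k * c.t) ↔ c.side (g⁻¹ * k) :=
        c.side_mul_t _ fun h => hne (inv_mul_eq_one.1 h).symm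
      rw [mul_assoc] at h1
      have h2 : c.side (g⁻¹ * k) ↔ ¬ c.side (g⁻¹ * (k * c.t)) := h
      tauto
    have hmul : ∀ g k : F, g • (k : F ⧸ c.B) = ((g * k : F) : F ⧸ c.B) := fun _ _ => rfl
    have h1 : ∀ g : F, ¬ c.cosetSide (g⁻¹ • (g : F ⧸ c.B)) := by
      intro g
      rw [hmul, inv_mul_cancel]
      exact c.side_one
    have h2 : ∀ g : F, c.cosetSide (g⁻¹ • ((g * c.t : F) : F ⧸ c.B)) := by
      intro g
      rw [hmul, inv_mul_cancel_left]
      exact c.side_t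
    intro x y hxy
    rcases c.cosetGraph_adj.1 hxy with ⟨g, rfl, rfl⟩ | ⟨g, rfl, rfl⟩
    · refine ⟨fun p => ¬ c.cosetSide (g⁻¹ • p), ⟨h1 g, not_not.2 (h2 g)⟩, ?_⟩
      intro a b hab ha hb
      dsimp only at ha hb
      rcases c.cosetGraph_adj.1 hab with ⟨k, rfl, rfl⟩ | ⟨k, rfl, rfl⟩
      · rw [hmul] at ha hb
        rw [hside g k (by tauto)]
      · rw [hmul] at ha hb
        rw [hside g k (by tauto), Sym2.eq_swap]
    · refine ⟨fun p => c.cosetSide (g⁻¹ • p), ⟨h2 g, h1 g⟩, ?_⟩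
      intro a b hab ha hb
      dsimp only at ha hb
      rcases c.cosetGraph_adj.1 hab with ⟨k, rfl, rfl⟩ | ⟨k, rfl, rfl⟩
      · rw [hmul] at ha hb
        rw [hside g k (by tauto), Sym2.eq_swap]
      · rw [hmul] at ha hb
        rw [hside g k (by tauto)]

lemma not_swap (g h : F) : ¬ (h • (g : F ⧸ c.B) = ((g * c.t : F) : F ⧸ c.B) ∧
    h • ((g * c.t : F) : F ⧸ c.B) = (g : F ⧸ c.B)) := by
  rintro ⟨h1, h2⟩
  have e1 : (g * c.t)⁻¹ * (h * g) ∈ c.B := QuotientGroup.eq.1 h1.symm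
  have e2 : g⁻¹ * (h * (g * c.t)) ∈ c.B := QuotientGroup.eq.1 h2.symm
  have h3 : c.side (c.t * ((g * c.t)⁻¹ * (h * g))) := (c.side_mul _ _ e1).2 c.side_t
  have h4 : c.side (c.t * ((g * c.t)⁻¹ * (h * g)) * c.t) := by
    rw [c.side_mul_t]
    · exact h3
    · intro h; rw [h] at h3; exact c.side_one h3
  refine c.not_side_of_mem e2 ?_
  convert h4 using 1
  group

/-- The Bass-Serre tree of the free product of `B` and `⟨t⟩`, as an HNN extension of `B` over the
trivial group. -/
def splitting : Splitting F where
  V := F ⧸ c.B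
  tree := c.cosetGraph
  isTree := c.cosetGraph_isTree
  action := inferInstance
  smul_adj := by
    intro g v w h
    rw [c.cosetGraph_adj] at h ⊢
    rcases h with ⟨k, rfl, rfl⟩ | ⟨k, rfl, rfl⟩
    · exact Or.inl ⟨g * k, rfl, by rw [mul_assoc]; rfl⟩
    · exact Or.inr ⟨g * k, rfl, by rw [mul_assoc]; rfl⟩
  no_inversion := by
    intro h v w hvw
    rcases c.cosetGraph_adj.1 hvw with ⟨g, rfl, rfl⟩ | ⟨g, rfl, rfl⟩
    · exact c.not_swap g h
    · exact fun h' => c.not_swap g h ⟨h'.2, h'.1⟩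

lemma mem_vertexGroup_iff {g h : F} :
    h ∈ c.splitting.vertexGroup (g : F ⧸ c.B) ↔ g⁻¹ * h * g ∈ c.B := by
  rw [mul_assoc, ← QuotientGroup.eq]
  exact eq_comm

lemma edgeGroup_eq_bot {v w : c.splitting.V} (hvw : c.splitting.tree.Adj v w) :
    c.splitting.edgeGroup v w = ⊥ := by
  have key : ∀ g : F, c.splitting.edgeGroup (g : F ⧸ c.B) ((g * c.t : F) : F ⧸ c.B) = ⊥ := by
    intro g
    rw [Subgroup.eq_bot_iff_forall]
    rintro h ⟨h1, h2⟩
    have e1 := c.mem_vertexGroup_iff.1 h1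
    have e2 := c.mem_vertexGroup_iff.1 h2
    by_contra hne
    have hne' : g⁻¹ * h * g ≠ 1 := by
      rw [mul_assoc, Ne, inv_mul_eq_one, eq_comm, mul_eq_right]
      exact hne
    have h3 : c.side (c.t * ((g * c.t)⁻¹ * h * (g * c.t))) := (c.side_mul _ _ e2).2 c.side_t
    have h4 : c.side (g⁻¹ * h * g * c.t) := by
      convert h3 using 1
      group
    rw [c.side_mul_t _ hne'] at h4
    exact c.not_side_of_mem e1 h4
  rcases c.cosetGraph_adj.1 hvw with ⟨g, rfl, rfl⟩ | ⟨g, rfl, rfl⟩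
  · exact key g
  · exact (inf_comm _ _).trans (key g)

lemma exists_mem_vertexGroup_not_isOfFinOrder (v : c.splitting.V) :
    ∃ h ∈ c.splitting.vertexGroup v, ¬ IsOfFinOrder h := by
  obtain ⟨g, rfl⟩ := QuotientGroup.mk_surjective v
  obtain ⟨b, hb, hb'⟩ := c.exists_not_isOfFinOrder
  refine ⟨g * b * g⁻¹, c.mem_vertexGroup_iff.2 ?_, fun h => hb' ?_⟩
  · simpa [mul_assoc] using hb
  · have := (MulAut.conj g⁻¹).toMonoidHom.isOfFinOrder h
    simpa [mul_assoc] using this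

lemma isHyperbolicElement_of_χ_ne_one {h : F} (hh : c.χ h ≠ 1) :
    c.splitting.IsHyperbolicElement h := by
  intro v hv
  obtain ⟨g, rfl⟩ := QuotientGroup.mk_surjective v
  have := c.χ_B _ (c.mem_vertexGroup_iff.1 hv)
  rw [map_mul, map_mul, map_inv, mul_comm, mul_inv_cancel_left] at this
  exact hh this

end FreeCut

/-! ### Complexities and volumes -/

namespace Splitting

variable {G : Type u} [Group G] {T : Splitting G}

lemma reverse_reverse (e : T.QuotientEdge) : T.reverse (T.reverse e) = e := by
  induction e using Quotient.inductionOn with | _ d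
  exact congrArg (Quotient.mk _) d.symm_symm

/-- The first Betti number of a graph is at least the number of edges minus the number of
vertices. The edges are counted by a choice `e` of oriented edges among which no two are mutually
reverse. -/
lemma card_le_quotientRank_add_card [Finite T.QuotientVertex] {ι : Type u} [Finite ι]
    (e : ι → T.QuotientEdge) (he : Function.Injective e) (he' : ∀ i j, e i ≠ T.reverse (e j)) :
    (Nat.card ι : ℕ∞) ≤ T.quotientRank + Nat.card T.QuotientVertex := by
  have hrev : Function.Injective T.reverse :=
    Function.LeftInverse.injective T.reverse_reverse
  let Φ : (ι →₀ ℚ) →ₗ[ℚ] (T.QuotientEdge →₀ ℚ) :=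
    Finsupp.lmapDomain ℚ ℚ e - Finsupp.lmapDomain ℚ ℚ (T.reverse ∘ e)
  have hΦ : ∀ c, Φ c = Finsupp.mapDomain e c - Finsupp.mapDomain (T.reverse ∘ e) c :=
    fun _ => rfl
  have hΦinj : Function.Injective Φ := by
    rw [← LinearMap.ker_eq_bot, LinearMap.ker_eq_bot']
    intro c hc
    ext i
    have := DFunLike.congr_fun hc (e i)
    rw [hΦ, Finsupp.sub_apply, Finsupp.mapDomain_apply he, Finsupp.mapDomain_of_notMem_range,
      sub_zero] at this
    · exact this
    · rintro ⟨j, hj⟩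
      exact he' i j hj.symm
  have hanti : ∀ c x, Φ c (T.reverse x) = - Φ c x := by
    intro c x
    have h1 : ∀ (f : T.QuotientEdge →₀ ℚ) y, Finsupp.mapDomain T.reverse f (T.reverse y) = f y :=
      fun f y => Finsupp.mapDomain_apply hrev f y
    have h2 : ∀ (f : T.QuotientEdge →₀ ℚ) y, Finsupp.mapDomain T.reverse f y =
        f (T.reverse y) := fun f y => by rw [← h1 f, reverse_reverse]
    rw [hΦ, Finsupp.mapDomain_comp, Finsupp.sub_apply, Finsupp.sub_apply, h1, h2]
    ring
  let ψ : (ι →₀ ℚ) →ₗ[ℚ] (T.QuotientVertex →₀ ℚ) :=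
    Finsupp.lmapDomain ℚ ℚ T.origin ∘ₗ Φ
  let Ψ : LinearMap.ker ψ →ₗ[ℚ] T.quotientCycles :=
    LinearMap.codRestrict _ (Φ ∘ₗ (LinearMap.ker ψ).subtype) fun c => ⟨hanti c, c.2⟩
  have hΨ : Function.Injective Ψ := fun a b hab =>
    Subtype.ext (hΦinj (congrArg Subtype.val hab))
  have h1 : Module.rank ℚ (LinearMap.ker ψ) ≤ Module.rank ℚ T.quotientCycles :=
    LinearMap.rank_le_of_injective Ψ hΨ
  have h2 := LinearMap.rank_range_add_rank_ker ψ
  have hrank : ∀ (κ : Type u) [Finite κ], Module.rank ℚ (κ →₀ ℚ) = Nat.card κ := fun κ _ => by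
    have := Fintype.ofFinite κ
    rw [← Module.finrank_eq_rank, Module.finrank_finsupp_self, Nat.card_eq_fintype_card]
  have h3 : Module.rank ℚ (LinearMap.range ψ) ≤ Nat.card T.QuotientVertex := by
    exact (Submodule.rank_le _).trans (hrank _).le
  have h4 : (Nat.card ι : Cardinal.{u}) ≤ Module.rank ℚ T.quotientCycles +
      Nat.card T.QuotientVertex := by
    rw [← hrank ι, ← h2, add_comm]
    exact add_le_add h1 h3
  have h5 := OrderHomClass.mono Cardinal.toENat h4
  rw [map_add, Cardinal.toENat_nat, Cardinal.toENat_nat] at h5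
  exact h5

end Splitting

lemma le_splittingVolume {P : (Γ : Type u) → [Group Γ] → Splitting Γ → Prop}
    {φ : (Γ : Type u) → [Group Γ] → ℝ≥0∞} {G : Type u} [Group G] {a : ℝ≥0∞}
    (h : ∀ H : FiniteIndexNormalSubgroup G,
      a * (H.toSubgroup.index : ℝ≥0∞) ≤ maxComplexity P φ H.toSubgroup) :
    a ≤ splittingVolume P φ G := by
  have : Nonempty (FiniteIndexNormalSubgroup G) := ⟨{ toSubgroup := ⊤ }⟩
  refine Filter.le_limsup_of_frequently_le (Filter.Frequently.of_forall fun H => ?_)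
  rw [ENNReal.le_div_iff_mul_le (Or.inl ?_) (Or.inl (ENNReal.natCast_ne_top _))]
  · exact h H
  · exact Nat.cast_ne_zero.2 Subgroup.FiniteIndex.index_ne_zero

lemma weightedComplexity_le_maxComplexity {P : (Γ : Type u) → [Group Γ] → Splitting Γ → Prop}
    {φ : (Γ : Type u) → [Group Γ] → ℝ≥0∞} {G : Type u} [Group G] {T : Splitting G}
    (hT : T.IsReduced) (hP : P G T) : T.weightedComplexity φ ≤ maxComplexity P φ G :=
  le_iSup₂_of_le T ⟨hT, hP⟩ le_rfl

namespace FreeCut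

variable {F L : Type u} [Group F] [Group L] {j : L →* F}

lemma comap_edgeGroup_eq_bot_and_vertexGroup_ne_bot (c : FreeCut F)
    (hj : Function.Injective j) (hidx : j.range.index ≠ 0)
    (v w : c.splitting.V) (hvw : c.splitting.tree.Adj v w) :
    (c.splitting.comap j).edgeGroup v w = ⊥ ∧ (c.splitting.comap j).vertexGroup v ≠ ⊥ := by
  constructor
  · rw [Splitting.comap_edgeGroup, c.edgeGroup_eq_bot hvw]
    exact (MonoidHom.ker_eq_bot_iff j).2 hj
  · obtain ⟨h, hh, hh'⟩ := c.exists_mem_vertexGroup_not_isOfFinOrder v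
    have := Splitting.infinite_comap_of_not_isOfFinOrder hidx hh hh'
    intro hbot
    rw [Splitting.comap_vertexGroup] at hbot
    rw [hbot] at this
    exact not_finite (⊥ : Subgroup L)

/-- The maximal complexity of a subgroup of finite index of a nonabelian free group is at least
its index, because the quotient of the Bass-Serre tree of the free product has that many edges. -/
lemma index_le_maxComplexity (c : FreeCut F) (hj : Function.Injective j)
    (hidx : j.range.index ≠ 0) :
    (j.range.index : ℝ≥0∞) ≤
      maxComplexity (fun _ _ T => T.HasFiniteEdgeGroups) (fun _ _ => 0) L := by
  set T := c.splitting.comap j with hT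
  have key := c.comap_edgeGroup_eq_bot_and_vertexGroup_ne_bot hj hidx
  have hred : T.IsReduced := fun v w hvw _ => by
    have h1 := key v w hvw
    have h2 := key w v hvw.symm
    refine ⟨fun h => h1.2 (h.symm.trans h1.1), fun h => h2.2 (h.symm.trans h1.1)⟩
  have hfe : T.HasFiniteEdgeGroups := fun v w hvw => by
    rw [(key v w hvw).1]
    infer_instance
  refine le_trans ?_ (weightedComplexity_le_maxComplexity hred hfe)
  have hnd : ∀ v, ¬ T.IsDegenerate v := by
    rintro v ⟨w, hvw, h⟩
    exact (key v w hvw).2 (h.symm.trans (key v w hvw).1)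
  have hhyp : ∃ g : L, T.IsHyperbolicElement g := by
    obtain ⟨n, hn, -, l, hl⟩ := Subgroup.exists_pow_mem_of_index_ne_zero hidx c.t
    refine ⟨l, fun v => ?_⟩
    have := c.χ_t_pow_ne_one (n := n) (by omega)
    rw [zpow_natCast, ← hl] at this
    exact c.isHyperbolicElement_of_χ_ne_one this v
  rw [Splitting.weightedComplexity, if_pos hhyp]
  have hfin₀ : Finite c.splitting.QuotientVertex := by
    refine Finite.of_surjective (fun _ : Unit => Quotient.mk _ ((1 : F) : F ⧸ c.B)) fun q => ?_
    induction q using Quotient.inductionOn with | _ v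
    obtain ⟨g, rfl⟩ := QuotientGroup.mk_surjective v
    refine ⟨(), Quotient.sound ⟨g⁻¹, ?_⟩⟩
    exact congrArg (fun x : F => (x : F ⧸ c.B)) (inv_mul_cancel g)
  have hfin : Finite T.QuotientVertex := Splitting.finite_quotientVertex_comap hidx
  have : Finite (F ⧸ j.range) := (Nat.card_ne_zero.1 hidx).2
  let d : F → T.tree.Dart := fun g =>
    ⟨((g : F ⧸ c.B), ((g * c.t : F) : F ⧸ c.B)), c.cosetGraph_adj_mk g⟩
  have hle := Splitting.card_le_quotientRank_add_card (T := T) (ι := F ⧸ j.range)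
    (fun q => Quotient.mk _ (d (q.out)⁻¹)) ?_ ?_
  · have hsum : (Nat.card T.QuotientVertex : ℝ≥0∞) ≤
        ∑' q : {q : T.QuotientVertex // ¬ T.IsDegenerate q.out}, (1 + 0 : ℝ≥0∞) := by
      have h1 : ∀ q : T.QuotientVertex, ¬ T.IsDegenerate q.out := fun q => hnd _
      have := Fintype.ofFinite {q : T.QuotientVertex // ¬ T.IsDegenerate q.out}
      rw [tsum_fintype, add_zero, Finset.sum_const, nsmul_one, Finset.card_univ,
        ← Nat.card_eq_fintype_card, Nat.card_congr (Equiv.subtypeUnivEquiv h1)]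
    refine le_trans ?_ (add_le_add le_rfl hsum)
    have := ENat.toENNReal_le.2 hle
    rw [ENat.toENNReal_add] at this
    exact_mod_cast this
  · intro q q' hqq
    obtain ⟨l, hl⟩ := Quotient.exact hqq
    have e1 : j l • (((q'.out)⁻¹ : F) : F ⧸ c.B) = (((q.out)⁻¹ : F) : F ⧸ c.B) :=
      congrArg (fun d : T.tree.Dart => d.fst) hl
    have e2 : j l • (((q'.out)⁻¹ * c.t : F) : F ⧸ c.B) = (((q.out)⁻¹ * c.t : F) : F ⧸ c.B) :=
      congrArg (fun d : T.tree.Dart => d.snd) hl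
    have e3 : (q.out)⁻¹ * (j l * (q'.out)⁻¹)⁻¹ ∈ c.splitting.edgeGroup
        ((j l * (q'.out)⁻¹ : F) : F ⧸ c.B) ((j l * (q'.out)⁻¹ * c.t : F) : F ⧸ c.B) := by
      constructor
      · refine Eq.trans ?_ e1.symm
        exact congrArg (fun x : F => (x : F ⧸ c.B)) (inv_mul_cancel_right _ _)
      · refine Eq.trans ?_ (e2.symm.trans ?_)
        · refine congrArg (fun x : F => (x : F ⧸ c.B)) (?_ : _ * (_ * _) = _)
          group
        · exact congrArg (fun x : F => (x : F ⧸ c.B)) (mul_assoc _ _ _).symm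
    rw [c.edgeGroup_eq_bot (c.cosetGraph_adj_mk _), Subgroup.mem_bot, mul_inv_eq_one] at e3
    rw [← QuotientGroup.out_eq' q, ← QuotientGroup.out_eq' q', QuotientGroup.eq, e3,
      inv_mul_cancel_right]
    exact ⟨l, rfl⟩
  · intro q q' hqq
    obtain ⟨l, hl⟩ := Quotient.exact hqq
    have e1 : j l • (((q'.out)⁻¹ * c.t : F) : F ⧸ c.B) = (((q.out)⁻¹ : F) : F ⧸ c.B) :=
      congrArg (fun d : T.tree.Dart => d.fst) hl
    have e2 : j l • (((q'.out)⁻¹ : F) : F ⧸ c.B) = (((q.out)⁻¹ * c.t : F) : F ⧸ c.B) :=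
      congrArg (fun d : T.tree.Dart => d.snd) hl
    refine c.not_swap (q.out)⁻¹ (j l * (q'.out)⁻¹ * (q.out)) ⟨?_, ?_⟩
    · refine Eq.trans ?_ e2
      refine congrArg (fun x : F => (x : F ⧸ c.B)) (?_ : _ * _ = _ * _)
      group
    · refine Eq.trans ?_ e1
      refine congrArg (fun x : F => (x : F ⧸ c.B)) (?_ : _ * (_ * _) = _ * (_ * _))
      group

/-- A group that maps onto a subgroup of finite index of a nonabelian free group is not cyclic. -/
lemma not_isCyclic (c : FreeCut F) (hidx : j.range.index ≠ 0) :
    ¬ IsCyclic L := by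
  intro hL
  obtain ⟨k, hk⟩ := hL.exists_generator
  obtain ⟨b, hb, hb'⟩ := c.exists_not_isOfFinOrder
  obtain ⟨n, hn, -, x, hx⟩ := Subgroup.exists_pow_mem_of_index_ne_zero hidx c.t
  obtain ⟨m, hm, -, y, hy⟩ := Subgroup.exists_pow_mem_of_index_ne_zero hidx b
  obtain ⟨p, rfl⟩ := hk x
  obtain ⟨q, rfl⟩ := hk y
  dsimp only at hx hy
  have h1 : c.t ^ (n * q : ℤ) = b ^ (m * p : ℤ) := by
    rw [zpow_mul, zpow_mul, zpow_natCast, zpow_natCast, ← hx, ← hy, ← map_zpow, ← map_zpow,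
      ← zpow_mul, ← zpow_mul, mul_comm]
  have h2 : c.χ (c.t ^ (n * q : ℤ)) = 1 := by
    rw [h1, map_zpow, c.χ_B b hb, one_zpow]
  have hq : q = 0 := by
    by_contra hq
    exact c.χ_t_pow_ne_one (mul_ne_zero (by omega) hq) h2
  subst hq
  rw [zpow_zero, map_one] at hy
  exact hb' (isOfFinOrder_iff_pow_eq_one.2 ⟨m, hm, hy.symm⟩)

end FreeCut

/-- Finitely generated free groups are finitely presented: a surjection `f` from a free group of
finite rank has a section `s`, and the elements `x⁻¹ * s (f x)` for `x` in the basis generate the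
kernel of `f` as a normal subgroup. -/
lemma isFinitelyPresented_of_isFreeGroup {K : Type u} [Group K] (hK : IsFreeGroup K)
    (hfg : Group.FG K) : Group.IsFinitelyPresented K := by
  obtain ⟨n, f, hf⟩ : ∃ (n : ℕ) (f : FreeGroup (Fin n) →* K), Function.Surjective f := by
    obtain ⟨S, hS⟩ := Group.fg_def.1 hfg
    refine ⟨S.card, FreeGroup.lift fun i => (S.equivFin.symm i : K), ?_⟩
    rw [← MonoidHom.range_eq_top, eq_top_iff, ← hS, Subgroup.closure_le]
    intro s hs
    exact ⟨FreeGroup.of (S.equivFin ⟨s, hs⟩), by simp⟩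
  have hf' := hf
  choose r hr using hf'
  let s : K →* FreeGroup (Fin n) := IsFreeGroup.lift fun a => r (IsFreeGroup.of a)
  have hfs : ∀ x, f (s x) = x := by
    have : f.comp s = MonoidHom.id K := IsFreeGroup.ext_hom fun a => by
      simp [s, hr]
    exact fun x => DFunLike.congr_fun this x
  refine Group.IsFinitelyPresented.of_surjective f hf ⟨Set.range fun i : Fin n =>
    (FreeGroup.of i)⁻¹ * s (f (FreeGroup.of i)), Set.finite_range _, le_antisymm ?_ ?_⟩
  · refine Subgroup.normalClosure_le_normal ?_
    rintro _ ⟨i, rfl⟩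
    rw [SetLike.mem_coe, MonoidHom.mem_ker, map_mul, map_inv, hfs, inv_mul_cancel]
  · set N := Subgroup.normalClosure (Set.range fun i : Fin n =>
      (FreeGroup.of i)⁻¹ * s (f (FreeGroup.of i)))
    have h : QuotientGroup.mk' N = ((QuotientGroup.mk' N).comp s).comp f := by
      ext i
      exact QuotientGroup.eq.2 (Subgroup.subset_normalClosure ⟨i, rfl⟩)
    intro x hx
    rw [← QuotientGroup.ker_mk' N, MonoidHom.mem_ker, h, MonoidHom.comp_apply,
      MonoidHom.mem_ker.1 hx, map_one]

/-- The weight of a subgroup of finite index in a finitely generated nonabelian free group is at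
least its index. -/
lemma FreeCut.index_le_hypWeight {F K : Type u} [Group F] [Group K] (c : FreeCut F)
    (hF : IsFreeGroup F) (hfg : Group.FG F) (htf : IsTorsionFreeGroup F) {j : K →* F}
    (hj : Function.Injective j) (hidx : j.range.index ≠ 0) :
    (j.range.index : ℝ≥0∞) ≤ hypWeight K := by
  have e : j.range ≃* K := (MonoidHom.ofInjective hj).symm
  have hfree : IsFreeGroup K := IsFreeGroup.ofMulEquiv e
  have : j.range.FiniteIndex := ⟨hidx⟩
  have hfgK : Group.FG K := by
    have := Subgroup.fg_of_index_ne_zero j.range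
    exact Group.fg_of_surjective (f := e.toMonoidHom) e.surjective
  have htfK : IsTorsionFreeGroup K := fun g hg =>
    hj ((htf _ (j.isOfFinOrder hg)).trans (map_one j).symm)
  rw [hypWeight, if_pos ⟨isFinitelyPresented_of_isFreeGroup hfree hfgK, htfK⟩]
  refine le_splittingVolume fun L => ?_
  have hrange : (j.comp L.toSubgroup.subtype).range.index = j.range.index * L.toSubgroup.index := by
    rw [MonoidHom.range_comp, Subgroup.range_subtype, Subgroup.index_map_of_injective _ hj,
      mul_comm]
  have h := c.index_le_maxComplexity (j := j.comp L.toSubgroup.subtype)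
    (hj.comp Subtype.val_injective) (by
      rw [hrange]; exact mul_ne_zero hidx Subgroup.FiniteIndex.index_ne_zero)
  rw [hrange, Nat.cast_mul] at h
  exact h

/-! ### Subgroups of finite index acting on a tree with a free vertex group -/

namespace Splitting

variable {G : Type u} [Group G] {T : Splitting G}

/-- For a normal subgroup `H`, the stabilizer in `H` of a translate of `v` is conjugate to the
intersection of `H` with the group of `v`. -/
lemma exists_vertexGroup_comap_hom (T : Splitting G) (H : Subgroup G) [hH : H.Normal] (v : T.V)
    (g : G) : ∃ j : (T.comap H.subtype).vertexGroup (g • v : T.V) →* T.vertexGroup v,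
      Function.Injective j ∧ j.range = H.subgroupOf (T.vertexGroup v) := by
  have hmem : ∀ h : (T.comap H.subtype).vertexGroup (g • v : T.V),
      g⁻¹ * (h : H) * g ∈ T.vertexGroup v := fun h => by
    rw [MulAction.mem_stabilizer_iff, mul_smul, mul_smul, inv_smul_eq_iff]
    exact h.2
  let j : (T.comap H.subtype).vertexGroup (g • v : T.V) →* T.vertexGroup v :=
    { toFun h := ⟨g⁻¹ * (h : H) * g, hmem h⟩
      map_one' := Subtype.ext (by simp)
      map_mul' a b := Subtype.ext (by simp [mul_assoc]) }
  refine ⟨j, fun a b hab => ?_, ?_⟩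
  · have := congrArg Subtype.val hab
    exact Subtype.ext (Subtype.ext (mul_left_cancel (mul_right_cancel this)))
  · ext u
    rw [MonoidHom.mem_range, Subgroup.mem_subgroupOf]
    constructor
    · rintro ⟨h, rfl⟩
      simpa [j] using hH.conj_mem _ (h : H).2 g⁻¹
    · intro hu
      refine ⟨⟨⟨g * u * g⁻¹, hH.conj_mem _ hu g⟩, ?_⟩, Subtype.ext ?_⟩
      · have h1 : (u : G) • v = v := u.2
        change (g * u * g⁻¹) • g • v = g • v
        rw [mul_smul, inv_smul_smul, mul_smul, h1]
      · simp [j, mul_assoc]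

/-- If some vertex with a group that is not cyclic is moved, there are hyperbolic elements. -/
lemma IsCyclicSplitting.exists_isHyperbolicElement (hT : T.IsCyclicSplitting) {v : T.V}
    (hv : ¬ IsCyclic (T.vertexGroup v)) {s : G} (hs : s • v ≠ v) :
    ∃ g, T.IsHyperbolicElement g :=
  Splitting.exists_isHyperbolicElement (fun w hvw hle => hv (by
    have := (hT v w hvw).1
    exact Subgroup.isCyclic_of_le (le_inf le_rfl hle))) hs

/-- A normal subgroup `H` of finite index has at least `[G : H] / [G_v : H_v]` orbits in the orbit
of `v`. The orbits are counted in the quotient of an `H`-tree whose vertices include that orbit. -/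
lemma index_le_card_mul_relIndex (T : Splitting G) (H : Subgroup G) [hH : H.Normal]
    [H.FiniteIndex] (v : T.V) {T' : Splitting H} (f : T'.V →[H] (T.comap H.subtype).V)
    (hf : ∀ g : G, (g • v : T.V) ∈ Set.range f) [Finite T'.QuotientVertex] :
    H.index ≤ Nat.card {q : T'.QuotientVertex //
      (f q.out : T.V) ∈ MulAction.orbit G v} * H.relIndex (T.vertexGroup v) := by
  have : Finite (T.vertexGroup v ⧸ H.subgroupOf (T.vertexGroup v)) := inferInstance
  choose γ hγ using fun q : {q : T'.QuotientVertex //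
      (f q.out : T.V) ∈ MulAction.orbit G v} => q.2
  rw [Subgroup.relIndex, Subgroup.index, Subgroup.index, ← Nat.card_prod]
  refine Nat.card_le_card_of_surjective
    (fun p => (QuotientGroup.mk (γ p.1 * p.2.out) : G ⧸ H)) fun x => ?_
  obtain ⟨g, rfl⟩ := QuotientGroup.mk_surjective x
  obtain ⟨y, hy⟩ := hf g
  obtain ⟨h, hh⟩ : (Quotient.mk _ y : T'.QuotientVertex).out ∈ MulAction.orbit H y :=
    MulAction.orbitRel_apply.1 (Quotient.exact (Quotient.out_eq _))
  have hfq : f (Quotient.mk _ y : T'.QuotientVertex).out = ((h : G) * g) • v := by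
    rw [← hh]
    refine (map_smul f h y).trans ?_
    rw [hy, mul_smul]
    rfl
  let q : {q : T'.QuotientVertex // (f q.out : T.V) ∈ MulAction.orbit G v} :=
    ⟨Quotient.mk _ y, ⟨(h : G) * g, hfq.symm⟩⟩
  have hu : (γ q)⁻¹ * ((h : G) * g) ∈ T.vertexGroup v := by
    rw [MulAction.mem_stabilizer_iff, mul_smul, inv_smul_eq_iff]
    exact hfq.symm.trans (hγ q).symm
  refine ⟨(q, QuotientGroup.mk ⟨_, hu⟩), QuotientGroup.eq.2 ?_⟩
  obtain ⟨⟨w, hw⟩, hw'⟩ := QuotientGroup.mk_out_eq_mul (H.subgroupOf (T.vertexGroup v))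
    ⟨_, hu⟩
  dsimp only
  rw [hw']
  have h1 : (γ q * ((⟨(γ q)⁻¹ * ((h : G) * g), hu⟩ * w : T.vertexGroup v) : G))⁻¹ * g =
      (w : G)⁻¹ * (g⁻¹ * (h : G)⁻¹ * g) := by
    rw [Subgroup.coe_mul]
    group
  rw [h1]
  exact H.mul_mem (H.inv_mem hw) (by simpa using hH.conj_mem _ (H.inv_mem h.2) g⁻¹)

/-- Let `G` act cocompactly and acylindrically with cyclic edge groups on a tree, and let `v` be a
vertex which is not fixed by `G` and has a finitely generated nonabelian free group. Each normal
subgroup of finite index of `G` then has complexity at least its index. -/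
lemma index_le_maxComplexity [Finite T.QuotientVertex] (hT : T.IsCyclicSplitting)
    (hac : T.IsAcylindrical) {v : T.V} (c : FreeCut (T.vertexGroup v))
    (hfree : IsFreeGroup (T.vertexGroup v)) (hfg : Group.FG (T.vertexGroup v))
    (htf : IsTorsionFreeGroup (T.vertexGroup v)) {s : G} (hs : s • v ≠ v)
    (H : Subgroup G) [hH : H.Normal] [hHfin : H.FiniteIndex] :
    (H.index : ℝ≥0∞) ≤ maxComplexity (fun _ _ T => T.IsCyclicSplitting ∧ T.IsAcylindrical)
      (fun Γ _ => hypWeight Γ) H := by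
  have hsub : Function.Injective H.subtype := Subtype.val_injective
  have hidx : H.subtype.range.index ≠ 0 := by
    rw [Subgroup.range_subtype]
    exact hHfin.index_ne_zero
  have hrel : (H.subgroupOf (T.vertexGroup v)).index ≠ 0 := Subgroup.FiniteIndex.index_ne_zero
  have hT₁ := hT.comap hsub hidx
  have : Finite (T.comap H.subtype).QuotientVertex := finite_quotientVertex_comap hidx
  obtain ⟨T', f, hf, hf', hred, hcyc', hac'⟩ :=
    exists_reduced (T.comap H.subtype) hT₁ (hac.comap hsub)
  have hnc : ∀ g : G, ¬ IsCyclic ((T.comap H.subtype).vertexGroup (g • v : T.V)) := fun g => by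
    obtain ⟨j, hj, hjr⟩ := T.exists_vertexGroup_comap_hom H v g
    exact c.not_isCyclic (j := j) (by rwa [hjr])
  have hweight : ∀ g : G, (H.relIndex (T.vertexGroup v) : ℝ≥0∞) ≤
      hypWeight ((T.comap H.subtype).vertexGroup (g • v : T.V)) := fun g => by
    obtain ⟨j, hj, hjr⟩ := T.exists_vertexGroup_comap_hom H v g
    have := c.index_le_hypWeight hfree hfg htf hj (by rwa [hjr])
    rwa [hjr] at this
  have hhyp : ∃ g : H, T'.IsHyperbolicElement g := by
    have hnc1 : ¬ IsCyclic ((T.comap H.subtype).vertexGroup v) := by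
      have := hnc 1
      rwa [show (1 : G) • v = v from one_smul G v] at this
    obtain ⟨k, hk⟩ : ∃ k : H, (k : G) • v ≠ v := by
      by_contra! hfix
      -- By normality, `H` fixes the two vertices `v` and `s • v`, so it is cyclic.
      refine hnc1 ?_
      have h1 := hT₁.isCyclic_inf (a := v) (b := (s • v : T.V)) hs.symm
      have hle : (T.comap H.subtype).vertexGroup v ≤
          (T.comap H.subtype).vertexGroup v ⊓ (T.comap H.subtype).vertexGroup (s • v : T.V) := by
        refine le_inf le_rfl fun k _ => ?_
        have h2 : (s⁻¹ * (k : G) * s) • v = v :=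
          hfix ⟨_, by simpa using hH.conj_mem _ k.2 s⁻¹⟩
        rw [mul_smul, mul_smul, inv_smul_eq_iff] at h2
        exact h2
      exact Subgroup.isCyclic_of_le hle
    obtain ⟨g, hg⟩ := hT₁.exists_isHyperbolicElement hnc1 hk
    exact ⟨g, fun y hy => hg (f y) (by rw [← map_smul, hy])⟩
  have hfin' : Finite T'.QuotientVertex :=
    Finite.of_injective _ (quotientVertexMap_injective f hf)
  refine le_trans ?_ (weightedComplexity_le_maxComplexity hred ⟨hcyc', hac'⟩)
  rw [weightedComplexity, if_pos hhyp]
  refine le_trans ?_ le_add_self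
  have hvg : ∀ q : {q : T'.QuotientVertex // (f q.out : T.V) ∈ MulAction.orbit G v},
      ∃ g : G, T'.vertexGroup q.1.out = (T.comap H.subtype).vertexGroup (g • v : T.V) := by
    rintro ⟨q, g, hg⟩
    refine ⟨g, (vertexGroup_apply_of_injective f hf q.out).symm.trans ?_⟩
    exact congrArg (T.comap H.subtype).vertexGroup hg.symm
  have hnd : ∀ q : {q : T'.QuotientVertex // (f q.out : T.V) ∈ MulAction.orbit G v},
      ¬ T'.IsDegenerate q.1.out := fun q => by
    obtain ⟨g, hg⟩ := hvg q
    exact hcyc'.not_isDegenerate (hg ▸ hnc g)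
  have hle := T.index_le_card_mul_relIndex H v f fun g => hf' _ (hnc g)
  calc (H.index : ℝ≥0∞) ≤ ∑' q : {q : T'.QuotientVertex //
        (f q.out : T.V) ∈ MulAction.orbit G v}, (H.relIndex (T.vertexGroup v) : ℝ≥0∞) := by
        have := Fintype.ofFinite {q : T'.QuotientVertex //
          (f q.out : T.V) ∈ MulAction.orbit G v}
        rw [tsum_fintype, Finset.sum_const, Finset.card_univ, ← Nat.card_eq_fintype_card,
          nsmul_eq_mul]
        exact_mod_cast hle
    _ ≤ ∑' q : {q : T'.QuotientVertex // (f q.out : T.V) ∈ MulAction.orbit G v},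
        (1 + hypWeight (T'.vertexGroup q.1.out)) := by
        refine ENNReal.tsum_le_tsum fun q => le_add_left ?_
        obtain ⟨g, hg⟩ := hvg q
        rw [hg]
        exact hweight g
    _ ≤ _ := ENNReal.tsum_comp_le_tsum_of_injective
        (f := fun q : {q : T'.QuotientVertex // (f q.out : T.V) ∈ MulAction.orbit G v} =>
          (⟨q.1, hnd q⟩ : {q : T'.QuotientVertex // ¬ T'.IsDegenerate q.out}))
        (fun a b hab => Subtype.ext (congrArg (fun q => q.1) hab))
        fun q => 1 + hypWeight (T'.vertexGroup q.1.out)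

end Splitting

theorem mainTheorem4 (G : Type u) [Group G] (hhyp : IsHyperbolicGroup G)
    (htf : IsTorsionFreeGroup G) (hend : IsOneEndedGroup G)
    (T : Splitting G) (hT : T.IsCyclicSplitting) (v : T.V)
    (hfree : IsFreeGroup (T.vertexGroup v))
    (hnonab : ∃ a b : T.vertexGroup v, a * b ≠ b * a) :
    0 < V1hyp G := by
  have hfg : Group.FG G := by
    obtain ⟨S, hS, -⟩ := hhyp
    exact Group.fg_def.2 ⟨S, hS⟩
  obtain ⟨T₀, f, hf, hadj, ⟨v, rfl⟩, hfin⟩ := T.exists_cocompact v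
  have hvg := Splitting.vertexGroup_apply_of_injective f hf
  have hT₀ : T₀.IsCyclicSplitting := fun x y hxy => by
    have := hT _ _ (hadj x y hxy)
    rwa [Splitting.edgeGroup, hvg, hvg] at this
  rw [hvg] at hfree hnonab
  obtain ⟨s, hs⟩ : ∃ s : G, s • v ≠ v := by
    by_contra! hfix
    -- Otherwise `G` is free and nonabelian, hence not one-ended.
    have htop : T₀.vertexGroup v = ⊤ := eq_top_iff.2 fun g _ => hfix g
    rw [htop] at hfree hnonab
    obtain ⟨c⟩ := (IsFreeGroup.ofMulEquiv (Subgroup.topEquiv (G := G))).nonempty_freeCut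
      (by
        obtain ⟨a, b, hab⟩ := hnonab
        exact ⟨a, b, fun h => hab (Subtype.ext h)⟩)
    exact c.not_isOneEndedGroup hend
  obtain ⟨c⟩ := hfree.nonempty_freeCut hnonab
  have : Finite T₀.QuotientVertex := Splitting.finite_quotientVertex
  have hle : 1 ≤ V1hyp G := le_splittingVolume fun H => by
    rw [one_mul]
    refine Splitting.index_le_maxComplexity hT₀
      (Splitting.isAcylindrical_of_isHyperbolicGroup hhyp hT₀) c hfree
      ((Group.fg_iff_subgroup_fg _).2 (Splitting.fg_vertexGroup hT₀ v)) (fun g hg => ?_) hs _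
    exact Subtype.ext (htf _ (Submonoid.isOfFinOrder_coe.2 hg))
  exact zero_lt_one.trans_le hle
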